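/- **Setting (contextual combinatorial semi-bandits, PAC).** Let $1\le m\le K$, $\mathcal Y=\{1,\dots,K\}$, let $\mathcal A$ be the set of all $m$-element subsets of $\mathcal Y$, and let $\Pi$ be a finite nonempty class of (measurable) policies $\pi:\mathcal X\to\mathcal A$. Let $\mathcal D$ be an unknown distribution of pairs $(x,r)$ of a context $x\in\mathcal X$ and a reward vector $r\in[0,1]^K$ with $\|r\|_1\le s$, where $s\le K$ is known. In each round the environment draws $(x_i,r_i)\sim\mathcal D$ independently, the learner sees $x_i$, plays $a_i\in\mathcal A$ and observes only $r_i(y)$ for $y\in a_i$. Put $r_{\mathcal D}(\pi)=\mathbb E_{(x,r)\sim\mathcal D}\big[\sum_{y\in\pi(x)}r(y)\big]$ and let $\pi^\star$ maximize $r_{\mathcal D}$ over $\Pi$. The learner has access to an oracle $\mathsf{ERM}_\Pi$ which on a finite data set of pairs $(x_i,\hat r_i)\in\mathcal X\times\mathbb R_+^K$ returns some $\pi\in\Pi$ maximizing $\sum_i\sum_{y\in\pi(x_i)}\hat r_i(y)$. For a probability vector $p$ on $\Pi$ and $\gamma\in(0,1)$ let $Q^\gamma_p(x,y)=(1-\gamma)\sum_{\pi\in\Pi}p(\pi)\mathbf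 1[y\in\pi(x)]+\gamma m/K$. **Algorithm PAC-COMBAND** (parameters $N_1,N_2,T,\gamma$). *Phase 1:* play $N_1$ rounds with $a_i$ uniform in $\mathcal A$. Start from any point mass $p_1$ on $\Pi$; for $t=1,\dots,T$ let $\pi_t=\mathsf{ERM}_\Pi((x_i,\hat r_i)_{i\le N_1})$ with $\hat r_i(y)=\frac1{N_1}(1-\gamma)\frac Km\,\frac{\mathbf 1[y\in a_i]\,r_i(y)}{Q^\gamma_{p_t}(x_i,y)}$, and let $p_{t+1}=(1-\eta_t)p_t+\eta_t\mathbf 1_{\pi_t}$ with $\eta_t=\frac2{2+t}$. Put $\hat p=p_{T+1}$. *Phase 2:* play $N_2$ new rounds, in which $a_i$ is uniform in $\mathcal A$ with probability $\gamma$ and otherwise $a_i=\pi_i(x_i)$ with $\pi_i\sim\hat p$. Output $\pi_{\rm out}=\mathsf{ERM}_\Pi((x_i,\hat r_i)_{i\le N_2})$ with $\hat r_i(y)=\frac{\mathbf 1[y\in a_i]\,r_i(y)}{Q^\gamma_{\hat p}(x_i,y)}$. **Theorem.** There is an absolute constant $c>0$ such that the following holds for all such instances, all $\varepsilon>0$,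 all $\delta\in(0,1)$, every $\mathsf{ERM}_\Pi$ oracle and every initial point mass. Let $\gamma=\frac12$ and let $N_1,N_2,T$ be natural numbers with $$N_1\ge\Big\lfloor c\,\frac{K^9}{m^8}\log\frac{|\Pi|}\delta\Big\rfloor,\qquad N_2\ge\Big\lfloor c\Big(\frac{sK}{m\varepsilon}+\frac{sm}{\varepsilon^2}\Big)\log\frac{|\Pi|}\delta\Big\rfloor,\qquad T\ge\Big\lfloor c\Big(\frac Km\Big)^5\Big\rfloor .$$ Then with probability at least $1-\delta$ PAC-COMBAND outputs $\pi_{\rm out}\in\Pi$ with $r_{\mathcal D}(\pi^\star)-r_{\mathcal D}(\pi_{\rm out})\le\varepsilon$, and it uses exactly $N_1+N_2$ samples and $T+1$ calls to $\mathsf{ERM}_\Pi$. Moreover, for every $c'\ge c$ there is a constant $C$ depending only on $c'$ such that, if $N_1$ and $N_2$ are at most the quantities inside the first two floors with $c'$ in place of $c$, then $$N_1+N_2\le C\Big(\frac{K^9}{m^8}+\frac{sm}{\varepsilon^2}\Big)\log\frac{|\Pi|}\delta ,$$ and if $T\le c'(K/m)^5$, then $T+1\le C(K/m)^5$. -/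

import Mathlib

open MeasureTheory ProbabilityTheory

noncomputable section

namespace SemiBandit

/-- The combinatorial actions: subsets of size `m` of the `K` basic actions. -/
def Action (K m : ℕ) : Type := {a : Finset (Fin K) // a.card = m}

instance (K m : ℕ) : Fintype (Action K m) :=
  inferInstanceAs (Fintype {a : Finset (Fin K) // a.card = m})

instance (K m : ℕ) : MeasurableSpace (Action K m) := ⊤

instance (K m : ℕ) : DiscreteMeasurableSpace (Action K m) := ⟨fun _ => trivial⟩

/-- What the learner sees in one round: the context `x`, its own action `a`, and the semi-bandit
feedback, that is the reward vector with all coordinates outside of `a` erased. -/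
abbrev Obs (X : Type*) (K m : ℕ) : Type _ := X × Action K m × (Fin K → ℝ)

/-- The observation produced by the context-reward pair `z = (x, r)` and the action `a`. -/
def observe {X : Type*} {K m : ℕ} (z : X × (Fin K → ℝ)) (a : Action K m) : Obs X K m :=
  (z.1, a, fun y => if y ∈ a.1 then z.2 y else 0)

/-- Law of the observation of one round: `(x, r)` is drawn from `D`, and then the action is drawn
from `α x`. -/
def roundLaw {X : Type*} [MeasurableSpace X] {K m : ℕ} (D : Measure (X × (Fin K → ℝ)))
    (α : X → Measure (Action K m)) : Measure (Obs X K m) :=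
  D.bind fun z => (α z.1).map (observe z)

/-- Expected reward `r_D(π) = E_{(x,r) ∼ D} [∑_{y ∈ π(x)} r(y)]` of a policy. -/
def policyReward {X : Type*} [MeasurableSpace X] {K m : ℕ} (D : Measure (X × (Fin K → ℝ)))
    (π : X → Action K m) : ℝ :=
  ∫ z, ∑ y ∈ (π z.1).1, z.2 y ∂D

/-- The policy with index `j` is `ε`-optimal in the class `pol`: its expected reward is within `ε`
of that of every policy of the (finite) class, hence of the best one. -/
def EpsOptimal {X : Type*} [MeasurableSpace X] {K m : ℕ} {ι : Type*}
    (D : Measure (X × (Fin K → ℝ))) (pol : ι → X → Action K m) (ε : ℝ) (j : ι) : Prop :=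
  ∀ j' : ι, policyReward D (pol j') - policyReward D (pol j) ≤ ε

/-- A finite data set of contexts with (estimated) reward vectors. -/
abbrev DataSet (X : Type*) (K n : ℕ) : Type _ := Fin n → X × (Fin K → ℝ)

/-- `erm` is an ERM oracle of the class `pol`: on every data set with nonnegative reward vectors it
returns a policy of maximal total reward on the data set. Ties are broken measurably. -/
structure IsERMOracle {X : Type*} [MeasurableSpace X] {K m : ℕ} {ι : Type*}
    (pol : ι → X → Action K m) (erm : ∀ n : ℕ, DataSet X K n → ι) : Prop where
  optimal : ∀ (n : ℕ) (S : DataSet X K n), (∀ i y, 0 ≤ (S i).2 y) → ∀ j : ι,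
    ∑ i, ∑ y ∈ (pol j (S i).1).1, (S i).2 y ≤ ∑ i, ∑ y ∈ (pol (erm n S) (S i).1).1, (S i).2 y
  measurable : ∀ (n : ℕ) (j : ι), MeasurableSet {S : DataSet X K n | erm n S = j}

/-- Programs of a learner. `explore n α next` plays `n` rounds, in each of which the action is drawn
from `α x` after the context `x` was received, and continues with `next` on the `n` observations;
`erm n S next` calls the ERM oracle on the data set `S` and continues with `next` on the answer;
`output j` stops and outputs the policy with index `j`. -/
inductive Learner (X : Type*) (K m : ℕ) (ι : Type*) : Type _
  | output (j : ι) : Learner X K m ι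
  | explore (n : ℕ) (α : X → Measure (Action K m)) (next : (Fin n → Obs X K m) → Learner X K m ι) :
      Learner X K m ι
  | erm (n : ℕ) (S : DataSet X K n) (next : ι → Learner X K m ι) : Learner X K m ι

/-- Outcome of a run: the policy that is output, the number of samples of the environment that were
used, and the number of calls to the ERM oracle. -/
structure Outcome (ι : Type*) where
  policy : ι
  samples : ℕ
  ermCalls : ℕ

instance (ι : Type*) : MeasurableSpace (Outcome ι) := ⊤

instance (ι : Type*) : DiscreteMeasurableSpace (Outcome ι) := ⟨fun _ => trivial⟩

/-- Law of the outcome of a learner, when the context-reward pairs of the rounds are i.i.d. with law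
`D` and the calls to the ERM oracle are answered by `oracle`. -/
def Learner.law {X : Type*} [MeasurableSpace X] {K m : ℕ} {ι : Type*}
    (D : Measure (X × (Fin K → ℝ))) (oracle : ∀ n : ℕ, DataSet X K n → ι) :
    Learner X K m ι → Measure (Outcome ι)
  | .output j => Measure.dirac ⟨j, 0, 0⟩
  | .explore n α next =>
      (Measure.pi fun _ : Fin n => roundLaw D α).bind fun S =>
        ((next S).law D oracle).map fun o => { o with samples := o.samples + n }
  | .erm n S next =>
      ((next (oracle n S)).law D oracle).map fun o => { o with ermCalls := o.ermCalls + 1 }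

section Algorithm

variable {X : Type*} {K m : ℕ} {ι : Type*} [Fintype ι]

/-- `Q_p(x, y)`: the probability that `y ∈ π(x)` for `π ∼ p`. -/
def coverProb (pol : ι → X → Action K m) (p : ι → ℝ) (x : X) (y : Fin K) : ℝ :=
  ∑ j, p j * (if y ∈ (pol j x).1 then 1 else 0)

/-- `Q_p^γ(x, y) = (1 - γ) Q_p(x, y) + γ m / K`. -/
def mixProb (pol : ι → X → Action K m) (γ : ℝ) (p : ι → ℝ) (x : X) (y : Fin K) : ℝ :=
  (1 - γ) * coverProb pol p x y + γ * m / K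

/-- The action law which with probability `γ` is uniform over all actions, and otherwise plays
`π(x)` for `π ∼ p`. -/
def mixLaw (pol : ι → X → Action K m) (γ : ℝ) (p : ι → ℝ) (x : X) : Measure (Action K m) :=
  ENNReal.ofReal γ • uniformOn Set.univ +
    ENNReal.ofReal (1 - γ) • ∑ j, ENNReal.ofReal (p j) • Measure.dirac (pol j x)

/-- Importance-weighted reward estimates `𝟙[y ∈ a] r(y) / Q_p^γ(x, y)`. -/
def ipsReward (pol : ι → X → Action K m) (γ : ℝ) (p : ι → ℝ) (o : Obs X K m) (y : Fin K) : ℝ :=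
  (if y ∈ o.2.1.1 then o.2.2 y else 0) / mixProb pol γ p o.1 y

/-- The data set passed to the ERM oracle in a Frank-Wolfe step at `p`. -/
def fwData (pol : ι → X → Action K m) (γ : ℝ) {N₁ : ℕ} (S : Fin N₁ → Obs X K m) (p : ι → ℝ) :
    DataSet X K N₁ :=
  fun i => ((S i).1, fun y => 1 / N₁ * (1 - γ) * (K / m) * ipsReward pol γ p (S i) y)

open Classical in
/-- The point mass on `j`, as a probability vector. -/
def delta (j : ι) : ι → ℝ := fun j' => if j' = j then 1 else 0

/-- The Frank-Wolfe iterations number `t, …, t + n - 1` from the iterate `p`, with step sizes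
`η_t = 2 / (2 + t)`; the final iterate is handed to `next`. -/
def frankWolfe (pol : ι → X → Action K m) (γ : ℝ) {N₁ : ℕ} (S : Fin N₁ → Obs X K m)
    (next : (ι → ℝ) → Learner X K m ι) : (n t : ℕ) → (p : ι → ℝ) → Learner X K m ι
  | 0, _, p => next p
  | n + 1, t, p => .erm N₁ (fwData pol γ S p) fun j =>
      frankWolfe pol γ S next n (t + 1)
        (fun i => (1 - 2 / (2 + (t : ℝ))) * p i + 2 / (2 + (t : ℝ)) * delta j i)

/-- The algorithm PAC-COMBAND, with the point mass on `j₀` as the initial iterate. -/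
def pacComband (pol : ι → X → Action K m) (γ : ℝ) (N₁ N₂ T : ℕ) (j₀ : ι) : Learner X K m ι :=
  .explore N₁ (fun _ => uniformOn Set.univ) fun S₁ =>
    frankWolfe pol γ S₁ (n := T) (t := 1) (p := delta j₀) fun p =>
      .explore N₂ (mixLaw pol γ p) fun S₂ =>
        .erm N₂ (fun i => ((S₂ i).1, ipsReward pol γ p (S₂ i))) fun j => .output j

end Algorithm

end SemiBandit

end

open SemiBandit

/-!
Both phases estimate rewards by importance weighting. In the second phase the estimate of a policy
`π` is unbiased, it is at most `2 s K / m`, and its second moment is at most `m * M(π)`, where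
`M(π) = E [∑_{y ∈ π(x)} r(y) / Q_p^γ(x, y)]` (`ipsMoment`). If `M(π) = O(s)` for all `π`, then
Bernstein's inequality and a union bound over the policies give the stated `N₂` (`phase_two`). The
task of the first phase is to find a mixture `p` with `M(π) = O(s)` for all `π`.

Such a mixture exists: a minimiser `p` of the log barrier `-E [∑_y r(y) log Q_p^γ(x, y)]` satisfies
`(1 - γ) M(π) ≤ E [∑_y r(y)] ≤ s`, by its first-order condition. The first phase runs Frank–Wolfe
on the empirical version of this barrier, and the oracle solves the linear subproblems. The
curvature of the barrier is at most `g⁻²` times the total observed reward, where `g = γ m / K` is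
the least value of `Q_p^γ`, so the iterates approach the minimum at the rate `1 / T`
(`fwIter_logBarrier_le`). A further step of length `g / 4` towards `π` shows that the empirical
version of `M(π)` is at most a constant times the total observed reward as soon as `T` is of the
order `(K / m) ^ 3` (`logBarrier_gradient_le`, `fwIter_ipsReward_le`), and this total concentrates
at its mean.

It remains to pass from the empirical to the true `M(π)`, uniformly over all mixtures `p`, because
the one in use depends on the data. Let `p'` be the uniform mixture of `k ≥ 1 / g` independent draws
from `p`. Then `1 / Q_p ≤ E [1 / Q_{p'}] ≤ 2 / Q_p`, by Jensen's inequality and a variance bound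
(`inv_le_iid_average`). Hence it suffices to compare the two versions of `M(π)` for the
`|Π| ^ k` uniform mixtures of `k = 2 K` policies, where a relative Chernoff bound and a union bound
apply (`phase_one`).
-/

namespace SemiBandit

/-! ### Frank–Wolfe on the log barrier -/

/-- The log barrier `-∑ a, c a * log (Q a)`. Its gradient at `Q` in the direction `V` is
`-∑ a, c a * V a / Q a`, the importance-weighted sum that the ERM oracle maximises. -/
noncomputable def logBarrier {A : Type*} [Fintype A] (c Q : A → ℝ) : ℝ :=
  -∑ a, c a * Real.log (Q a)

/-- The first-order convexity inequality of the log barrier. -/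
lemma logBarrier_sub_le {A : Type*} [Fintype A] {c Q R : A → ℝ} (hc : ∀ a, 0 ≤ c a)
    (hQ : ∀ a, 0 < Q a) (hR : ∀ a, 0 < R a) :
    logBarrier c Q - logBarrier c R ≤ ∑ a, c a * (R a / Q a - 1) := by
  unfold logBarrier
  rw [neg_sub_neg, ← Finset.sum_sub_distrib]
  refine Finset.sum_le_sum fun a _ => ?_
  rw [← mul_sub, ← Real.log_div (hR a).ne' (hQ a).ne']
  exact mul_le_mul_of_nonneg_left (Real.log_le_sub_one_of_pos (div_pos (hR a) (hQ a))) (hc a)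

/-- The second-order expansion of `x / w` at `w = x`, for `w` a convex combination of `x` and `v`. -/
lemma div_convexComb_sub_one {x v η w : ℝ} (hx : x ≠ 0) (hw : w ≠ 0)
    (h : w = (1 - η) * x + η * v) :
    x / w - 1 = η - η * (v / x) + η ^ 2 * ((v - x) ^ 2 / (x * w)) := by
  field_simp
  rw [h]
  ring

/-- A Frank–Wolfe step with step size `2 / (2 + t)` carries the rate `4 B / (t + 2)` from `t` to
`t + 1`. Here `g⁻² ∑ c` bounds the curvature of the log barrier on `[g, 1]`. -/
lemma logBarrier_frankWolfe_step {A : Type*} [Fintype A] {c Q R V : A → ℝ} {g t : ℝ}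
    (hc : ∀ a, 0 ≤ c a) (hg : 0 < g) (ht : 1 ≤ t) (hQ : ∀ a, g ≤ Q a ∧ Q a ≤ 1)
    (hV : ∀ a, g ≤ V a ∧ V a ≤ 1) (hR : ∀ a, 0 < R a)
    (hmax : ∑ a, c a * (R a / Q a) ≤ ∑ a, c a * (V a / Q a))
    (hrate : logBarrier c Q - logBarrier c R ≤ 4 * ((∑ a, c a) / g ^ 2) / (t + 2)) :
    logBarrier c (fun a => (1 - 2 / (2 + t)) * Q a + 2 / (2 + t) * V a) - logBarrier c R ≤
      4 * ((∑ a, c a) / g ^ 2) / (t + 1 + 2) := by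
  set η : ℝ := 2 / (2 + t) with hη
  set B : ℝ := (∑ a, c a) / g ^ 2 with hB
  have hη0 : 0 < η := by positivity
  have hη1 : η ≤ 1 := by rw [hη, div_le_one (by positivity)]; linarith
  have hB0 : 0 ≤ B := div_nonneg (Finset.sum_nonneg fun a _ => hc a) (by positivity)
  have hQ0 : ∀ a, 0 < Q a := fun a => hg.trans_le (hQ a).1
  have hW : ∀ a, g ≤ (1 - η) * Q a + η * V a := fun a => by
    nlinarith [mul_nonneg (sub_nonneg.2 hη1) (sub_nonneg.2 (hQ a).1),
      mul_nonneg hη0.le (sub_nonneg.2 (hV a).1)]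
  have hW0 : ∀ a, 0 < (1 - η) * Q a + η * V a := fun a => hg.trans_le (hW a)
  have hstep := logBarrier_sub_le hc hW0 hQ0
  have hpt : ∀ a, c a * (Q a / ((1 - η) * Q a + η * V a) - 1) ≤
      η * c a - η * (c a * (V a / Q a)) + η ^ 2 * (c a / g ^ 2) := fun a => by
    have hq := hQ0 a
    have hw := hW0 a
    have h1 : Q a / ((1 - η) * Q a + η * V a) - 1 =
        η - η * (V a / Q a) + η ^ 2 * ((V a - Q a) ^ 2 / (Q a * ((1 - η) * Q a + η * V a))) :=
      div_convexComb_sub_one hq.ne' hw.ne' rfl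
    have h2 : (V a - Q a) ^ 2 / (Q a * ((1 - η) * Q a + η * V a)) ≤ 1 / g ^ 2 := by
      apply div_le_div₀ zero_le_one _ (by positivity) _
      · have := hQ a
        have := hV a
        nlinarith
      · rw [sq]
        exact mul_le_mul (hQ a).1 (hW a) hg.le hq.le
    rw [h1]
    have h3 := mul_le_mul_of_nonneg_left h2 (mul_nonneg (hc a) (sq_nonneg η))
    calc _ = c a * η - η * (c a * (V a / Q a)) + c a * η ^ 2 *
            ((V a - Q a) ^ 2 / (Q a * ((1 - η) * Q a + η * V a))) := by ring
      _ ≤ c a * η - η * (c a * (V a / Q a)) + c a * η ^ 2 * (1 / g ^ 2) := by linarith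
      _ = _ := by ring
  have hsum := Finset.sum_le_sum fun a (_ : a ∈ Finset.univ) => hpt a
  rw [Finset.sum_add_distrib, Finset.sum_sub_distrib, ← Finset.mul_sum, ← Finset.mul_sum,
    ← Finset.mul_sum, ← Finset.sum_div, ← hB] at hsum
  have hconv := logBarrier_sub_le hc hQ0 hR
  simp only [mul_sub, mul_one, Finset.sum_sub_distrib] at hconv
  have hkey : logBarrier c (fun a => (1 - η) * Q a + η * V a) - logBarrier c R ≤
      (1 - η) * (logBarrier c Q - logBarrier c R) + η ^ 2 * B := by
    nlinarith [mul_le_mul_of_nonneg_left (hconv.trans (sub_le_sub_right hmax _)) hη0.le]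
  refine hkey.trans ?_
  have h5 := mul_le_mul_of_nonneg_left hrate (sub_nonneg.2 hη1)
  refine (add_le_add_left h5 _).trans ?_
  have h6 : (1 - η) * (4 * B / (t + 2)) + η ^ 2 * B = 4 * B * ((t + 1) / (t + 2) ^ 2) := by
    rw [hη]
    field_simp
    ring
  -- It remains to see `(t + 1) / (t + 2) ^ 2 ≤ 1 / (t + 3)`.
  rw [h6, div_eq_mul_one_div (4 * B) (t + 1 + 2)]
  refine mul_le_mul_of_nonneg_left ?_ (by positivity)
  rw [div_le_div_iff₀ (by positivity) (by positivity)]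
  nlinarith

/-- The gradient of the log barrier at a near-minimiser `Q` is controlled in every direction `V`
in which a step of length `g / 4` improves the barrier by at most `h`. -/
lemma logBarrier_gradient_le {A : Type*} [Fintype A] {c Q V : A → ℝ} {g h : ℝ}
    (hc : ∀ a, 0 ≤ c a) (hg : 0 < g) (hg1 : g ≤ 1) (hQ : ∀ a, g ≤ Q a)
    (hV : ∀ a, g ≤ V a ∧ V a ≤ 1)
    (hmin : logBarrier c Q - logBarrier c (fun a => (1 - g / 4) * Q a + g / 4 * V a) ≤ h) :
    ∑ a, c a * (V a / Q a) ≤ 4 * ∑ a, c a + 8 * h / g := by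
  set η : ℝ := g / 4 with hη
  have hη0 : 0 < η := by positivity
  have hη1 : η ≤ 1 / 2 := by rw [hη]; linarith
  have hQ0 : ∀ a, 0 < Q a := fun a => hg.trans_le (hQ a)
  have hW : ∀ a, Q a / 2 ≤ (1 - η) * Q a + η * V a := fun a => by
    nlinarith [mul_pos hη0 (hg.trans_le (hV a).1), hQ0 a]
  have hW0 : ∀ a, 0 < (1 - η) * Q a + η * V a := fun a => (half_pos (hQ0 a)).trans_le (hW a)
  have hstep := logBarrier_sub_le hc hW0 hQ0
  have hpt : ∀ a, c a * (Q a / ((1 - η) * Q a + η * V a) - 1) ≤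
      (η + 2 * η ^ 2) * c a - (η / 2) * (c a * (V a / Q a)) := fun a => by
    have hq := hQ0 a
    have hw := hW0 a
    have hv := hg.trans_le (hV a).1
    have h1 : Q a / ((1 - η) * Q a + η * V a) - 1 =
        η - η * (V a / Q a) + η ^ 2 * ((V a - Q a) ^ 2 / (Q a * ((1 - η) * Q a + η * V a))) :=
      div_convexComb_sub_one hq.ne' hw.ne' rfl
    have h2 : (V a - Q a) ^ 2 / (Q a * ((1 - η) * Q a + η * V a)) ≤ 2 * (V a / Q a) / g + 2 := by
      have h3 : (V a - Q a) ^ 2 / (Q a * ((1 - η) * Q a + η * V a)) ≤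
          (V a + Q a ^ 2) / (Q a * (Q a / 2)) := by
        apply div_le_div₀ (by positivity) _ (by positivity) _
        · have := (hV a).2
          nlinarith
        · exact mul_le_mul_of_nonneg_left (hW a) hq.le
      refine h3.trans ?_
      have h4 : (V a + Q a ^ 2) / (Q a * (Q a / 2)) = 2 * (V a / Q a) / Q a + 2 := by
        field_simp
      rw [h4]
      have : 2 * (V a / Q a) / Q a ≤ 2 * (V a / Q a) / g :=
        div_le_div_of_nonneg_left (by positivity) hg (hQ a)
      linarith
    rw [h1]
    have h3 : η - η * (V a / Q a) +
        η ^ 2 * ((V a - Q a) ^ 2 / (Q a * ((1 - η) * Q a + η * V a))) ≤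
        (η + 2 * η ^ 2) - η / 2 * (V a / Q a) := by
      have h5 := mul_le_mul_of_nonneg_left h2 (sq_nonneg η)
      have h6 : η ^ 2 * (2 * (V a / Q a) / g + 2) = η / 2 * (V a / Q a) + 2 * η ^ 2 := by
        rw [hη]
        field_simp
        ring
      linarith
    calc _ ≤ c a * ((η + 2 * η ^ 2) - η / 2 * (V a / Q a)) := mul_le_mul_of_nonneg_left h3 (hc a)
      _ = _ := by ring
  have hsum := Finset.sum_le_sum fun a (_ : a ∈ Finset.univ) => hpt a
  rw [Finset.sum_sub_distrib, ← Finset.mul_sum, ← Finset.mul_sum] at hsum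
  have hS : 0 ≤ ∑ a, c a := Finset.sum_nonneg fun a _ => hc a
  have h7 : η / 2 * ∑ a, c a * (V a / Q a) ≤ (η + 2 * η ^ 2) * ∑ a, c a + h := by linarith
  have h8 : (η + 2 * η ^ 2) * ∑ a, c a ≤ 2 * η * ∑ a, c a :=
    mul_le_mul_of_nonneg_right (by nlinarith) hS
  have h9 : ∑ a, c a * (V a / Q a) ≤ (2 * η * ∑ a, c a + h) / (η / 2) := by
    rw [le_div_iff₀ (by positivity)]
    linarith
  refine h9.trans (le_of_eq ?_)
  rw [hη]
  field_simp
  ring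

/-! ### Sparsification of a mixture of policies -/

/-- The mean and the second moment of a sum of `k` independent copies of a centred function on a
finite probability space. -/
lemma iid_sum_moments {ι : Type*} [Fintype ι] {p : ι → ℝ} (hp : ∑ j, p j = 1) {f : ι → ℝ}
    (hf : ∑ j, p j * f j = 0) (k : ℕ) :
    ∑ J : Fin k → ι, ∏ i, p (J i) = 1 ∧
    ∑ J : Fin k → ι, (∏ i, p (J i)) * ∑ i, f (J i) = 0 ∧
    ∑ J : Fin k → ι, (∏ i, p (J i)) * (∑ i, f (J i)) ^ 2 = k * ∑ j, p j * f j ^ 2 := by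
  induction k with
  | zero => simp
  | succ k ih =>
    obtain ⟨h0, h1, h2⟩ := ih
    have hsplit : ∀ F : (Fin (k + 1) → ι) → ℝ,
        ∑ J, F J = ∑ j, ∑ J : Fin k → ι, F (Fin.cons j J) := fun F => by
      rw [← Fintype.sum_prod_type', ← (Fin.consEquiv fun _ => ι).sum_comp]
      rfl
    refine ⟨?_, ?_, ?_⟩
    · simp only [hsplit, Fin.prod_univ_succ, Fin.cons_zero, Fin.cons_succ, ← Finset.mul_sum, h0,
        mul_one, hp]
    · simp only [hsplit, Fin.prod_univ_succ, Fin.sum_univ_succ, Fin.cons_zero, Fin.cons_succ,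
        mul_add, Finset.sum_add_distrib]
      have e1 : ∀ j, ∑ J : Fin k → ι, p j * (∏ i, p (J i)) * f j = p j * f j := fun j => by
        rw [← Finset.sum_mul, ← Finset.mul_sum, h0, mul_one]
      have e2 : ∀ j, ∑ J : Fin k → ι, p j * (∏ i, p (J i)) * ∑ i, f (J i) = 0 := fun j => by
        simp only [mul_assoc]
        rw [← Finset.mul_sum, h1, mul_zero]
      simp only [e1, e2, hf, Finset.sum_const_zero, add_zero]
    · simp only [hsplit, Fin.prod_univ_succ, Fin.sum_univ_succ, Fin.cons_zero, Fin.cons_succ]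
      have e : ∀ j, ∑ J : Fin k → ι, p j * (∏ i, p (J i)) * (f j + ∑ i, f (J i)) ^ 2 =
          p j * f j ^ 2 + p j * (k * ∑ j, p j * f j ^ 2) := fun j => by
        have : ∀ J : Fin k → ι, p j * (∏ i, p (J i)) * (f j + ∑ i, f (J i)) ^ 2 =
            p j * f j ^ 2 * (∏ i, p (J i)) + 2 * p j * f j * ((∏ i, p (J i)) * ∑ i, f (J i)) +
              p j * ((∏ i, p (J i)) * (∑ i, f (J i)) ^ 2) := fun J => by ring
        simp only [this, Finset.sum_add_distrib, ← Finset.mul_sum, h0, h1, h2]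
        ring
      simp only [e, Finset.sum_add_distrib, ← Finset.sum_mul, hp]
      push_cast
      ring

/-- Replacing a mixture by the average of `k ≥ 1 / g` independent draws from it changes the inverse
of a probability bounded below by `g` by at most a factor of two on average. The lower bound is
Jensen's inequality, the upper bound comes from the variance of the average. -/
lemma inv_le_iid_average {ι : Type*} [Fintype ι] {p : ι → ℝ} (hp : p ∈ stdSimplex ℝ ι)
    {b : ι → ℝ} (hb : ∀ j, b j = 0 ∨ b j = 1) {β g : ℝ} (hβ : 0 ≤ β) (hβ1 : β ≤ 1) (hg : 0 < g)
    {k : ℕ} (hk : 1 / g ≤ k) :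
    1 / (β * ∑ j, p j * b j + g) ≤
      ∑ J : Fin k → ι, (∏ i, p (J i)) * (1 / (β * ((∑ i, b (J i)) / k) + g)) ∧
    ∑ J : Fin k → ι, (∏ i, p (J i)) * (1 / (β * ((∑ i, b (J i)) / k) + g)) ≤
      2 * (1 / (β * ∑ j, p j * b j + g)) := by
  have hb0 : ∀ j, 0 ≤ b j := fun j => by rcases hb j with h | h <;> simp [h]
  have hk0 : (0 : ℝ) < k := lt_of_lt_of_le (by positivity) hk
  set q : ℝ := ∑ j, p j * b j with hq
  have hq0 : 0 ≤ q := Finset.sum_nonneg fun j _ => mul_nonneg (hp.1 j) (hb0 j)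
  have hf : ∑ j, p j * (b j - q) = 0 := by
    simp only [mul_sub, Finset.sum_sub_distrib, ← Finset.sum_mul, hp.2]
    rw [← hq]
    ring
  have hf2 : ∑ j, p j * (b j - q) ^ 2 ≤ q := by
    have : ∀ j, p j * (b j - q) ^ 2 = p j * b j - 2 * q * (p j * b j) + q ^ 2 * p j := fun j => by
      have : b j ^ 2 = b j := by rcases hb j with h | h <;> simp [h]
      linear_combination p j * this
    simp only [this, Finset.sum_add_distrib, Finset.sum_sub_distrib, ← Finset.mul_sum, hp.2]
    rw [← hq]
    nlinarith
  obtain ⟨m0, m1, m2⟩ := iid_sum_moments hp.2 hf k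
  have hw : ∀ J : Fin k → ι, 0 ≤ ∏ i, p (J i) := fun J => Finset.prod_nonneg fun i _ => hp.1 _
  set Q : ℝ := β * q + g with hQ
  have hQg : g ≤ Q := by rw [hQ]; nlinarith
  have hQ0 : 0 < Q := hg.trans_le hQg
  have hdiff : ∀ J : Fin k → ι,
      β * ((∑ i, b (J i)) / k) + g = Q + β / k * ∑ i, (b (J i) - q) := fun J => by
    rw [Finset.sum_sub_distrib, hQ]
    simp only [Finset.sum_const, Finset.card_univ, Fintype.card_fin, nsmul_eq_mul]
    field_simp
    ring
  have hQ' : ∀ J : Fin k → ι, g ≤ Q + β / k * ∑ i, (b (J i) - q) := fun J => by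
    rw [← hdiff]
    have : 0 ≤ β * ((∑ i, b (J i)) / k) :=
      mul_nonneg hβ (div_nonneg (Finset.sum_nonneg fun i _ => hb0 _) hk0.le)
    linarith
  simp only [hdiff]
  constructor
  · have hlow : ∀ J : Fin k → ι, (1 / Q) * ∏ i, p (J i) -
        β / k / Q ^ 2 * ((∏ i, p (J i)) * ∑ i, (b (J i) - q)) ≤
        (∏ i, p (J i)) * (1 / (Q + β / k * ∑ i, (b (J i) - q))) := fun J => by
      set Z := ∑ i, (b (J i) - q)
      have hpos : 0 < Q + β / k * Z := hg.trans_le (hQ' J)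
      have : 1 / Q - β / k / Q ^ 2 * Z ≤ 1 / (Q + β / k * Z) := by
        rw [show 1 / Q - β / k / Q ^ 2 * Z = (Q - β / k * Z) / Q ^ 2 by field_simp,
          div_le_div_iff₀ (by positivity) hpos]
        nlinarith [sq_nonneg (β / k * Z)]
      calc _ = (∏ i, p (J i)) * (1 / Q - β / k / Q ^ 2 * Z) := by ring
        _ ≤ _ := mul_le_mul_of_nonneg_left this (hw J)
    have := Finset.sum_le_sum fun J (_ : J ∈ Finset.univ) => hlow J
    rw [Finset.sum_sub_distrib, ← Finset.mul_sum, ← Finset.mul_sum, m0, m1] at this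
    linarith
  · have hupp : ∀ J : Fin k → ι,
        (∏ i, p (J i)) * (1 / (Q + β / k * ∑ i, (b (J i) - q))) ≤
        (1 / Q) * ∏ i, p (J i) - β / k / Q ^ 2 * ((∏ i, p (J i)) * ∑ i, (b (J i) - q)) +
          (β / k) ^ 2 / (Q ^ 2 * g) * ((∏ i, p (J i)) * (∑ i, (b (J i) - q)) ^ 2) := fun J => by
      set Z := ∑ i, (b (J i) - q)
      have hpos : 0 < Q + β / k * Z := hg.trans_le (hQ' J)
      have : 1 / (Q + β / k * Z) ≤
          1 / Q - β / k / Q ^ 2 * Z + (β / k) ^ 2 / (Q ^ 2 * g) * Z ^ 2 := by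
        have e : 1 / (Q + β / k * Z) = 1 / Q - β / k / Q ^ 2 * Z +
            (β / k * Z) ^ 2 / (Q ^ 2 * (Q + β / k * Z)) := by
          have := hpos.ne'
          generalize β / k = u at *
          field_simp
          ring
        rw [e]
        have : (β / k * Z) ^ 2 / (Q ^ 2 * (Q + β / k * Z)) ≤ (β / k * Z) ^ 2 / (Q ^ 2 * g) :=
          div_le_div_of_nonneg_left (by positivity) (by positivity)
            (mul_le_mul_of_nonneg_left (hQ' J) (by positivity))
        have e2 : (β / k) ^ 2 / (Q ^ 2 * g) * Z ^ 2 = (β / k * Z) ^ 2 / (Q ^ 2 * g) := by ring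
        linarith
      calc _ ≤ (∏ i, p (J i)) *
            (1 / Q - β / k / Q ^ 2 * Z + (β / k) ^ 2 / (Q ^ 2 * g) * Z ^ 2) :=
          mul_le_mul_of_nonneg_left this (hw J)
        _ = _ := by ring
    have := Finset.sum_le_sum fun J (_ : J ∈ Finset.univ) => hupp J
    rw [Finset.sum_add_distrib, Finset.sum_sub_distrib, ← Finset.mul_sum, ← Finset.mul_sum,
      ← Finset.mul_sum, m0, m1, m2] at this
    refine this.trans ?_
    have h1 : (β / k) ^ 2 / (Q ^ 2 * g) * (k * ∑ j, p j * (b j - q) ^ 2) ≤ 1 / Q := by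
      calc _ ≤ (β / k) ^ 2 / (Q ^ 2 * g) * (k * q) := by gcongr
        _ = (β * (β * q)) * (1 / g / k) / Q ^ 2 := by field_simp
        _ ≤ (1 * Q) * 1 / Q ^ 2 := by
          have : 1 / g / k ≤ 1 := by rwa [div_le_one hk0]
          have : β * q ≤ Q := by rw [hQ]; linarith
          gcongr
        _ = 1 / Q := by field_simp
    linarith

/-! ### Mixtures of policies -/

/-- The indicator of `y ∈ a`. -/
def hit {K m : ℕ} (a : Action K m) (y : Fin K) : ℝ := if y ∈ a.1 then 1 else 0

lemma hit_eq_zero_or_one {K m : ℕ} (a : Action K m) (y : Fin K) : hit a y = 0 ∨ hit a y = 1 := by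
  unfold hit; split_ifs <;> simp

lemma hit_nonneg {K m : ℕ} (a : Action K m) (y : Fin K) : 0 ≤ hit a y := by
  rcases hit_eq_zero_or_one a y with h | h <;> simp [h]

lemma hit_le_one {K m : ℕ} (a : Action K m) (y : Fin K) : hit a y ≤ 1 := by
  rcases hit_eq_zero_or_one a y with h | h <;> simp [h]

lemma sum_action_eq_sum_hit {K m : ℕ} (a : Action K m) (f : Fin K → ℝ) :
    ∑ y ∈ a.1, f y = ∑ y, hit a y * f y := by
  simp [hit]

lemma sum_hit {K m : ℕ} (a : Action K m) : ∑ y, hit a y = m := by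
  simp [hit, a.2]

section Mixtures

variable {X : Type*} {K m : ℕ} {ι : Type*} [Fintype ι] {pol : ι → X → Action K m}

lemma delta_mem_stdSimplex (j : ι) : delta j ∈ stdSimplex ℝ ι :=
  ⟨fun i => by unfold delta; split_ifs <;> simp, by
    rw [Finset.sum_eq_single j (fun i _ h => by simp [delta, h]) (by simp)]
    simp [delta]⟩

lemma coverProb_delta (j : ι) (x : X) (y : Fin K) :
    coverProb pol (delta j) x y = hit (pol j x) y := by
  rw [coverProb, Finset.sum_eq_single j (fun i _ h => by simp [delta, h]) (by simp)]
  simp [delta, hit]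

lemma coverProb_nonneg {p : ι → ℝ} (hp : p ∈ stdSimplex ℝ ι) (x : X) (y : Fin K) :
    0 ≤ coverProb pol p x y :=
  Finset.sum_nonneg fun j _ => mul_nonneg (hp.1 j) (hit_nonneg _ _)

lemma coverProb_le_one {p : ι → ℝ} (hp : p ∈ stdSimplex ℝ ι) (x : X) (y : Fin K) :
    coverProb pol p x y ≤ 1 := by
  rw [← hp.2]
  exact Finset.sum_le_sum fun j _ => mul_le_of_le_one_right (hp.1 j) (hit_le_one _ _)

lemma le_mixProb {γ : ℝ} (hγ1 : γ ≤ 1) {p : ι → ℝ} (hp : p ∈ stdSimplex ℝ ι)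
    (x : X) (y : Fin K) : γ * m / K ≤ mixProb pol γ p x y :=
  le_add_of_nonneg_left (mul_nonneg (sub_nonneg.2 hγ1) (coverProb_nonneg hp x y))

lemma mixProb_le_one {γ : ℝ} (hγ0 : 0 ≤ γ) (hγ1 : γ ≤ 1) (hmK : m ≤ K) {p : ι → ℝ}
    (hp : p ∈ stdSimplex ℝ ι) (x : X) (y : Fin K) : mixProb pol γ p x y ≤ 1 := by
  have h1 := mul_le_mul_of_nonneg_left (coverProb_le_one (pol := pol) hp x y) (sub_nonneg.2 hγ1)
  have h2 : γ * m / K ≤ γ := by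
    rw [mul_div_assoc]
    exact mul_le_of_le_one_right hγ0 (div_le_one_of_le₀ (by exact_mod_cast hmK) (by positivity))
  unfold mixProb
  linarith

lemma coverProb_convexComb (η : ℝ) (p q : ι → ℝ) (x : X) (y : Fin K) :
    coverProb pol (fun i => (1 - η) * p i + η * q i) x y =
      (1 - η) * coverProb pol p x y + η * coverProb pol q x y := by
  simp only [coverProb, Finset.mul_sum, ← Finset.sum_add_distrib]
  exact Finset.sum_congr rfl fun j _ => by ring

lemma mixProb_convexComb (γ η : ℝ) (p q : ι → ℝ) (x : X) (y : Fin K) :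
    mixProb pol γ (fun i => (1 - η) * p i + η * q i) x y =
      (1 - η) * mixProb pol γ p x y + η * mixProb pol γ q x y := by
  simp only [mixProb, coverProb_convexComb]
  ring

lemma mixProb_eq_sum_delta (γ : ℝ) {p : ι → ℝ} (hp : p ∈ stdSimplex ℝ ι) (x : X) (y : Fin K) :
    mixProb pol γ p x y = ∑ j, p j * mixProb pol γ (delta j) x y := by
  simp only [mixProb, coverProb_delta, mul_add, Finset.sum_add_distrib, ← Finset.sum_mul, hp.2,
    one_mul]
  congr 1
  simp only [coverProb, Finset.mul_sum]
  exact Finset.sum_congr rfl fun j _ => by rw [hit]; ring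

lemma convexComb_mem_stdSimplex {η : ℝ} (h0 : 0 ≤ η) (h1 : η ≤ 1) {p q : ι → ℝ}
    (hp : p ∈ stdSimplex ℝ ι) (hq : q ∈ stdSimplex ℝ ι) :
    (fun i => (1 - η) * p i + η * q i) ∈ stdSimplex ℝ ι :=
  convex_stdSimplex ℝ ι hp hq (sub_nonneg.2 h1) h0 (by ring)

end Mixtures

/-! ### The Frank–Wolfe phase of the algorithm -/

/-- The observed reward of the basic action `y`, which is zero if `y` was not played. -/
noncomputable def obsReward {X : Type*} {K m : ℕ} (o : Obs X K m) (y : Fin K) : ℝ :=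
  if y ∈ o.2.1.1 then o.2.2 y else 0

section FrankWolfe

variable {X : Type*} {K m : ℕ} {ι : Type*} [Fintype ι]

/-- The Frank–Wolfe update of the iterate number `t` towards the policy `j`. -/
noncomputable def fwStep (t : ℕ) (p : ι → ℝ) (j : ι) : ι → ℝ :=
  fun i => (1 - 2 / (2 + (t : ℝ))) * p i + 2 / (2 + (t : ℝ)) * delta j i

/-- The result of the Frank–Wolfe iterations number `t, …, t + n - 1` from the iterate `p`, as a
function of the answers of the oracle. -/
noncomputable def fwIter (pol : ι → X → Action K m) (γ : ℝ) (oracle : ∀ n : ℕ, DataSet X K n → ι)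
    {N : ℕ} (S : Fin N → Obs X K m) : ℕ → ℕ → (ι → ℝ) → (ι → ℝ)
  | 0, _, p => p
  | n + 1, t, p => fwIter pol γ oracle S n (t + 1) (fwStep t p (oracle N (fwData pol γ S p)))

variable {pol : ι → X → Action K m} {γ : ℝ} {oracle : ∀ n : ℕ, DataSet X K n → ι}
  {N : ℕ} {S : Fin N → Obs X K m}

lemma fwStep_mem_stdSimplex (t : ℕ) {p : ι → ℝ} (hp : p ∈ stdSimplex ℝ ι) (j : ι) (ht : 1 ≤ t) :
    fwStep t p j ∈ stdSimplex ℝ ι := by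
  refine convexComb_mem_stdSimplex (by positivity) ?_ hp (delta_mem_stdSimplex j)
  rw [div_le_one (by positivity)]
  linarith [t.cast_nonneg (α := ℝ)]

lemma fwIter_mem_stdSimplex (n : ℕ) : ∀ (t : ℕ) (p : ι → ℝ), 1 ≤ t → p ∈ stdSimplex ℝ ι →
    fwIter pol γ oracle S n t p ∈ stdSimplex ℝ ι := by
  induction n with
  | zero => exact fun _ _ _ hp => hp
  | succ n ih =>
    exact fun t p ht hp => ih _ _ (by omega) (fwStep_mem_stdSimplex t hp _ ht)

/-- The oracle answers the Frank–Wolfe query with a policy that minimises the linearisation of the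
log barrier over all mixtures of policies. -/
lemma fwData_oracle_le [MeasurableSpace X] (hO : IsERMOracle pol oracle) (hN : 0 < N) (hm : 0 < m)
    (hmK : m ≤ K) (hγ0 : 0 < γ) (hγ1 : γ < 1) (hS : ∀ i y, 0 ≤ obsReward (S i) y) {p q : ι → ℝ}
    (hp : p ∈ stdSimplex ℝ ι) (hq : q ∈ stdSimplex ℝ ι) :
    ∑ a : Fin N × Fin K, obsReward (S a.1) a.2 *
        (mixProb pol γ q (S a.1).1 a.2 / mixProb pol γ p (S a.1).1 a.2) ≤
      ∑ a : Fin N × Fin K, obsReward (S a.1) a.2 *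
        (mixProb pol γ (delta (oracle N (fwData pol γ S p))) (S a.1).1 a.2 /
          mixProb pol γ p (S a.1).1 a.2) := by
  have hK : (0 : ℝ) < K := by exact_mod_cast hm.trans_le hmK
  have hm' : (0 : ℝ) < m := by exact_mod_cast hm
  have hN' : (0 : ℝ) < N := by exact_mod_cast hN
  have hg : 0 < γ * m / K := by positivity
  have hQ : ∀ x y, 0 < mixProb pol γ p x y := fun x y => hg.trans_le (le_mixProb hγ1.le hp x y)
  set C : ℝ := 1 / N * (1 - γ) * (K / m) with hC
  have hC0 : 0 < C := by
    have : 0 < 1 - γ := sub_pos.2 hγ1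
    positivity
  set j₁ := oracle N (fwData pol γ S p)
  have hopt := hO.optimal N (fwData pol γ S p) fun i y =>
    mul_nonneg hC0.le (div_nonneg (hS i y) (hQ _ _).le)
  have hval : ∀ j, ∑ i, ∑ y ∈ (pol j (fwData pol γ S p i).1).1, (fwData pol γ S p i).2 y =
      C * ∑ a : Fin N × Fin K, hit (pol j (S a.1).1) a.2 *
        (obsReward (S a.1) a.2 / mixProb pol γ p (S a.1).1 a.2) := fun j => by
    rw [Fintype.sum_prod_type, Finset.mul_sum]
    refine Finset.sum_congr rfl fun i _ => ?_
    rw [sum_action_eq_sum_hit, Finset.mul_sum]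
    refine Finset.sum_congr rfl fun y _ => ?_
    change hit (pol j (S i).1) y * (C * (obsReward (S i) y / mixProb pol γ p (S i).1 y)) = _
    ring
  have hvert : ∀ j, ∑ a : Fin N × Fin K, obsReward (S a.1) a.2 *
        (mixProb pol γ (delta j) (S a.1).1 a.2 / mixProb pol γ p (S a.1).1 a.2) ≤
      ∑ a : Fin N × Fin K, obsReward (S a.1) a.2 *
        (mixProb pol γ (delta j₁) (S a.1).1 a.2 / mixProb pol γ p (S a.1).1 a.2) := fun j => by
    have h := hopt j
    rw [hval, hval, mul_le_mul_iff_right₀ hC0] at h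
    have e : ∀ j, ∑ a : Fin N × Fin K, obsReward (S a.1) a.2 *
        (mixProb pol γ (delta j) (S a.1).1 a.2 / mixProb pol γ p (S a.1).1 a.2) =
        (1 - γ) * ∑ a : Fin N × Fin K, hit (pol j (S a.1).1) a.2 *
          (obsReward (S a.1) a.2 / mixProb pol γ p (S a.1).1 a.2) +
        ∑ a : Fin N × Fin K, obsReward (S a.1) a.2 *
          (γ * m / K / mixProb pol γ p (S a.1).1 a.2) := fun j => by
      rw [Finset.mul_sum, ← Finset.sum_add_distrib]
      refine Finset.sum_congr rfl fun a _ => ?_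
      rw [show mixProb pol γ (delta j) (S a.1).1 a.2 =
        (1 - γ) * hit (pol j (S a.1).1) a.2 + γ * m / K by rw [mixProb, coverProb_delta]]
      ring
    rw [e, e]
    have := mul_le_mul_of_nonneg_left h (sub_nonneg.2 hγ1.le)
    linarith
  calc _ = ∑ j, q j * ∑ a : Fin N × Fin K, obsReward (S a.1) a.2 *
        (mixProb pol γ (delta j) (S a.1).1 a.2 / mixProb pol γ p (S a.1).1 a.2) := by
        simp only [mixProb_eq_sum_delta (pol := pol) γ hq, Finset.mul_sum, Finset.sum_div]
        rw [Finset.sum_comm]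
        exact Finset.sum_congr rfl fun j _ => Finset.sum_congr rfl fun a _ => by ring
    _ ≤ ∑ j, q j * ∑ a : Fin N × Fin K, obsReward (S a.1) a.2 *
        (mixProb pol γ (delta j₁) (S a.1).1 a.2 / mixProb pol γ p (S a.1).1 a.2) :=
        Finset.sum_le_sum fun j _ => mul_le_mul_of_nonneg_left (hvert j) (hq.1 j)
    _ = _ := by rw [← Finset.sum_mul, hq.2, one_mul]

/-- The Frank–Wolfe iterates approach the minimum of the log barrier over the mixtures of policies
at the rate `4 B / (t + 2)`. -/
lemma fwIter_logBarrier_le [MeasurableSpace X] (hO : IsERMOracle pol oracle) (hN : 0 < N)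
    (hm : 0 < m) (hmK : m ≤ K) (hγ0 : 0 < γ) (hγ1 : γ < 1)
    (hS : ∀ i y, 0 ≤ obsReward (S i) y) {q : ι → ℝ} (hq : q ∈ stdSimplex ℝ ι) {B : ℝ}
    (hB : B = (∑ a : Fin N × Fin K, obsReward (S a.1) a.2) / (γ * m / K) ^ 2) (n : ℕ) :
    ∀ (t : ℕ) (p : ι → ℝ), 1 ≤ t → p ∈ stdSimplex ℝ ι →
    logBarrier (fun a : Fin N × Fin K => obsReward (S a.1) a.2)
        (fun a => mixProb pol γ p (S a.1).1 a.2) -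
      logBarrier (fun a : Fin N × Fin K => obsReward (S a.1) a.2)
        (fun a => mixProb pol γ q (S a.1).1 a.2) ≤ 4 * B / (t + 2) →
    logBarrier (fun a : Fin N × Fin K => obsReward (S a.1) a.2)
        (fun a => mixProb pol γ (fwIter pol γ oracle S n t p) (S a.1).1 a.2) -
      logBarrier (fun a : Fin N × Fin K => obsReward (S a.1) a.2)
        (fun a => mixProb pol γ q (S a.1).1 a.2) ≤ 4 * B / ((t + n : ℕ) + 2) := by
  have hK : (0 : ℝ) < K := by exact_mod_cast hm.trans_le hmK
  have hm' : (0 : ℝ) < m := by exact_mod_cast hm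
  have hg : 0 < γ * m / K := by positivity
  have hbd : ∀ r : ι → ℝ, r ∈ stdSimplex ℝ ι → ∀ a : Fin N × Fin K,
      γ * m / K ≤ mixProb pol γ r (S a.1).1 a.2 ∧ mixProb pol γ r (S a.1).1 a.2 ≤ 1 :=
    fun r hr a => ⟨le_mixProb hγ1.le hr _ _, mixProb_le_one hγ0.le hγ1.le hmK hr _ _⟩
  induction n with
  | zero => exact fun t p _ _ h => h
  | succ n ih =>
    intro t p ht hp h
    have hstep := logBarrier_frankWolfe_step (t := t) (fun a : Fin N × Fin K => hS a.1 a.2) hg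
      (by exact_mod_cast ht) (hbd p hp)
      (hbd _ (delta_mem_stdSimplex (oracle N (fwData pol γ S p))))
      (fun a => hg.trans_le (hbd q hq a).1)
      (fwData_oracle_le hO hN hm hmK hγ0 hγ1 hS hp hq) (hB ▸ h)
    simp only [← mixProb_convexComb, ← hB] at hstep
    have := ih (t + 1) _ (by omega) (fwStep_mem_stdSimplex t hp (oracle N (fwData pol γ S p)) ht)
      (by push_cast; exact hstep)
    rwa [show t + 1 + n = t + (n + 1) by omega] at this

/-- After sufficiently many Frank–Wolfe iterations, the importance-weighted reward of every policy
is at most a constant times the total observed reward. -/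
lemma fwIter_ipsReward_le [MeasurableSpace X] (hO : IsERMOracle pol oracle) (hN : 0 < N)
    (hm : 0 < m) (hmK : m ≤ K) (hγ0 : 0 < γ) (hγ1 : γ < 1)
    (hS : ∀ i y, 0 ≤ obsReward (S i) y) {T : ℕ} (hT : 32 / (γ * m / K) ^ 3 ≤ T) (j₀ j : ι) :
    (1 - γ) * ∑ i, ∑ y, hit (pol j (S i).1) y *
        ipsReward pol γ (fwIter pol γ oracle S T 1 (delta j₀)) (S i) y ≤
      5 * ∑ i, ∑ y, obsReward (S i) y := by
  have hK : (0 : ℝ) < K := by exact_mod_cast hm.trans_le hmK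
  have hm' : (0 : ℝ) < m := by exact_mod_cast hm
  set g : ℝ := γ * m / K with hgdef
  have hg : 0 < g := by positivity
  have hbd : ∀ r : ι → ℝ, r ∈ stdSimplex ℝ ι → ∀ a : Fin N × Fin K,
      g ≤ mixProb pol γ r (S a.1).1 a.2 ∧ mixProb pol γ r (S a.1).1 a.2 ≤ 1 :=
    fun r hr a => ⟨le_mixProb hγ1.le hr _ _, mixProb_le_one hγ0.le hγ1.le hmK hr _ _⟩
  have hg1 : g ≤ 1 := by
    rw [hgdef, div_le_one hK]
    have : (m : ℝ) ≤ K := by exact_mod_cast hmK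
    nlinarith
  have hc : ∀ a : Fin N × Fin K, 0 ≤ obsReward (S a.1) a.2 := fun a => hS a.1 a.2
  set p := fwIter pol γ oracle S T 1 (delta j₀) with hpdef
  have hp : p ∈ stdSimplex ℝ ι := fwIter_mem_stdSimplex T 1 _ le_rfl (delta_mem_stdSimplex j₀)
  set s : ℝ := ∑ a : Fin N × Fin K, obsReward (S a.1) a.2 with hs
  have hs0 : 0 ≤ s := Finset.sum_nonneg fun a _ => hc a
  have hnear : ∀ q ∈ stdSimplex ℝ ι,
      logBarrier (fun a : Fin N × Fin K => obsReward (S a.1) a.2)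
        (fun a => mixProb pol γ p (S a.1).1 a.2) -
      logBarrier (fun a : Fin N × Fin K => obsReward (S a.1) a.2)
        (fun a => mixProb pol γ q (S a.1).1 a.2) ≤ 4 * (s / g ^ 2) / ((1 + T : ℕ) + 2) := by
    intro q hq
    refine fwIter_logBarrier_le hO hN hm hmK hγ0 hγ1 hS hq rfl T 1 _ le_rfl
      (delta_mem_stdSimplex j₀) ?_
    -- The initial gap is at most `s / g`, hence at most the required `4 / 3 * s / g ^ 2`.
    refine (logBarrier_sub_le hc (fun a => hg.trans_le (hbd _ (delta_mem_stdSimplex j₀) a).1)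
      (fun a => hg.trans_le (hbd q hq a).1)).trans ?_
    have hpt : ∀ a : Fin N × Fin K, obsReward (S a.1) a.2 *
        (mixProb pol γ q (S a.1).1 a.2 / mixProb pol γ (delta j₀) (S a.1).1 a.2 - 1) ≤
        1 / g * obsReward (S a.1) a.2 := fun a => by
      rw [mul_comm (1 / g)]
      refine mul_le_mul_of_nonneg_left ?_ (hc a)
      have h1 : mixProb pol γ q (S a.1).1 a.2 / mixProb pol γ (delta j₀) (S a.1).1 a.2 ≤ 1 / g :=
        div_le_div₀ zero_le_one (hbd q hq a).2 hg (hbd _ (delta_mem_stdSimplex j₀) a).1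
      linarith
    refine (Finset.sum_le_sum fun a _ => hpt a).trans ?_
    rw [← Finset.mul_sum, ← hs]
    rw [show 4 * (s / g ^ 2) / (((1 : ℕ) : ℝ) + 2) = 4 / 3 * (1 / g) * (1 / g * s) by
      push_cast; field_simp; norm_num]
    have : 1 ≤ 1 / g := by rwa [le_div_iff₀ hg, one_mul]
    have h2 : 0 ≤ 1 / g * s := by positivity
    nlinarith
  have hgrad := logBarrier_gradient_le hc hg hg1 (fun a => (hbd p hp a).1)
    (hbd _ (delta_mem_stdSimplex j)) (by
      have h := hnear _ (convexComb_mem_stdSimplex (η := g / 4) (by positivity) (by linarith) hp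
        (delta_mem_stdSimplex j))
      simp only [mixProb_convexComb] at h
      exact h)
  have hfin : 4 * s + 8 * (4 * (s / g ^ 2) / ((1 + T : ℕ) + 2)) / g ≤ 5 * s := by
    have h1 : 8 * (4 * (s / g ^ 2) / (((1 + T : ℕ) : ℝ) + 2)) / g =
        s * (32 / g ^ 3 / ((1 + T : ℕ) + 2)) := by
      field_simp
      ring
    have h2 : 32 / g ^ 3 / (((1 + T : ℕ) : ℝ) + 2) ≤ 1 := by
      rw [div_le_one (by positivity)]
      push_cast
      linarith
    rw [h1]
    nlinarith
  have hlow : (1 - γ) * ∑ i, ∑ y, hit (pol j (S i).1) y * ipsReward pol γ p (S i) y ≤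
      ∑ a : Fin N × Fin K, obsReward (S a.1) a.2 *
        (mixProb pol γ (delta j) (S a.1).1 a.2 / mixProb pol γ p (S a.1).1 a.2) := by
    rw [Fintype.sum_prod_type, Finset.mul_sum]
    refine Finset.sum_le_sum fun i _ => ?_
    rw [Finset.mul_sum]
    refine Finset.sum_le_sum fun y _ => ?_
    change (1 - γ) * (hit (pol j (S i).1) y * (obsReward (S i) y / mixProb pol γ p (S i).1 y)) ≤ _
    have hpos := hg.trans_le (hbd p hp (i, y)).1
    calc _ = obsReward (S i) y * ((1 - γ) * hit (pol j (S i).1) y / mixProb pol γ p (S i).1 y) := by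
          ring
      _ ≤ _ := by
          refine mul_le_mul_of_nonneg_left (div_le_div_of_nonneg_right ?_ hpos.le) (hS i y)
          rw [mixProb, coverProb_delta]
          exact le_add_of_nonneg_right hg.le
  rw [← Fintype.sum_prod_type (f := fun a : Fin N × Fin K => obsReward (S a.1) a.2)]
  exact hlow.trans (hgrad.trans hfin)

end FrankWolfe

/-! ### Concentration of sums of independent bounded variables -/

section Concentration

variable {Ω : Type*} [MeasurableSpace Ω] {μ : Measure Ω} [IsProbabilityMeasure μ]

/-- Chernoff's bound with the estimate `exp u ≤ 1 + u + u ^ 2` for `|u| ≤ 1`. -/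
lemma pi_real_le_exp {X : Ω → ℝ} (hX : Measurable X) (hbd : ∀ᵐ ω ∂μ, |X ω| ≤ 1) (n : ℕ) (a : ℝ) :
    (Measure.pi fun _ : Fin n => μ).real {S | a ≤ ∑ i, X (S i)} ≤
      Real.exp (n * (∫ ω, X ω ∂μ + ∫ ω, X ω ^ 2 ∂μ) - a) := by
  have hint : Integrable X μ := Integrable.of_bound hX.aestronglyMeasurable 1 hbd
  have hint2 : Integrable (fun ω => X ω ^ 2) μ :=
    Integrable.of_bound (hX.pow_const 2).aestronglyMeasurable 1 (by
      filter_upwards [hbd] with ω h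
      rw [Real.norm_eq_abs, abs_pow]
      exact pow_le_one₀ (abs_nonneg _) h)
  have hexp : Integrable (fun ω => Real.exp (X ω)) μ :=
    Integrable.of_bound (Real.measurable_exp.comp hX).aestronglyMeasurable (Real.exp 1) (by
      filter_upwards [hbd] with ω h
      rw [Real.norm_eq_abs, Real.abs_exp]
      exact Real.exp_le_exp.2 (le_of_abs_le h))
  have hmgf : ∫ ω, Real.exp (X ω) ∂μ ≤ Real.exp (∫ ω, X ω ∂μ + ∫ ω, X ω ^ 2 ∂μ) := by
    calc _ ≤ ∫ ω, (1 + (X ω + X ω ^ 2)) ∂μ := by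
          refine integral_mono_ae hexp ((integrable_const 1).add (hint.add hint2)) ?_
          filter_upwards [hbd] with ω h
          have := (abs_le.1 (Real.abs_exp_sub_one_sub_id_le h)).2
          linarith
      _ = 1 + (∫ ω, X ω ∂μ + ∫ ω, X ω ^ 2 ∂μ) := by
          have h1 : ∫ ω, (1 + (X ω + X ω ^ 2)) ∂μ = ∫ _, (1 : ℝ) ∂μ + ∫ ω, (X ω + X ω ^ 2) ∂μ :=
            integral_add (integrable_const 1) (hint.add hint2)
          rw [h1, integral_add hint hint2]
          simp
      _ ≤ _ := by
          rw [add_comm]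
          exact Real.add_one_le_exp _
  have hmeas : Measurable fun S : Fin n → Ω => ∑ i, X (S i) :=
    Finset.measurable_sum _ fun i _ => hX.comp (measurable_pi_apply i)
  have hae : ∀ᵐ S ∂(Measure.pi fun _ : Fin n => μ), ∀ i, |X (S i)| ≤ 1 := by
    rw [Filter.eventually_all]
    exact fun i => (Measure.tendsto_eval_ae_ae (μ := fun _ : Fin n => μ) (i := i)).eventually hbd
  have hint3 : Integrable (fun S : Fin n → Ω => Real.exp (1 * ∑ i, X (S i)))
      (Measure.pi fun _ : Fin n => μ) := by
    refine Integrable.of_bound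
      (Real.measurable_exp.comp (hmeas.const_mul 1)).aestronglyMeasurable (Real.exp n) ?_
    filter_upwards [hae] with S h
    rw [Real.norm_eq_abs, Real.abs_exp, one_mul]
    refine Real.exp_le_exp.2 ((Finset.sum_le_sum fun i _ => le_of_abs_le (h i)).trans ?_)
    simp
  refine (measure_ge_le_exp_mul_mgf a zero_le_one hint3).trans ?_
  have hprod : mgf (fun S : Fin n → Ω => ∑ i, X (S i)) (Measure.pi fun _ : Fin n => μ) 1 =
      (∫ ω, Real.exp (X ω) ∂μ) ^ n := by
    simp only [mgf, one_mul, Real.exp_sum]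
    rw [integral_fintype_prod_eq_prod (f := fun _ ω => Real.exp (X ω))]
    simp
  rw [hprod]
  calc _ ≤ Real.exp (-1 * a) * Real.exp (∫ ω, X ω ∂μ + ∫ ω, X ω ^ 2 ∂μ) ^ n := by
        gcongr
    _ = _ := by
        rw [← Real.exp_nat_mul, ← Real.exp_add]
        ring_nf

/-- The case of `pi_real_le_exp` of a multiple of a variable with a known bound on its second
moment. -/
lemma pi_real_mul_le_exp {Y : Ω → ℝ} (hY : Measurable Y) {c V : ℝ}
    (hbd : ∀ᵐ ω ∂μ, |c * Y ω| ≤ 1) (hV : ∫ ω, Y ω ^ 2 ∂μ ≤ V) (n : ℕ) (a : ℝ) :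
    (Measure.pi fun _ : Fin n => μ).real {S | a ≤ c * ∑ i, Y (S i)} ≤
      Real.exp (n * (c * ∫ ω, Y ω ∂μ + c ^ 2 * V) - a) := by
  have h := pi_real_le_exp (hY.const_mul c) hbd n a
  simp only [← Finset.mul_sum, mul_pow, integral_const_mul] at h
  refine h.trans (Real.exp_le_exp.2 ?_)
  gcongr

variable {Y : Ω → ℝ} {M : ℝ}

lemma integral_sq_le_of_bound (hY : Measurable Y) (hbd : ∀ᵐ ω ∂μ, 0 ≤ Y ω ∧ Y ω ≤ M) :
    ∫ ω, Y ω ^ 2 ∂μ ≤ M * ∫ ω, Y ω ∂μ := by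
  rw [← integral_const_mul]
  have hint : Integrable Y μ := Integrable.of_bound hY.aestronglyMeasurable M (by
    filter_upwards [hbd] with ω h
    rw [Real.norm_eq_abs, abs_of_nonneg h.1]
    exact h.2)
  refine integral_mono_of_nonneg (Filter.Eventually.of_forall fun ω => sq_nonneg _)
    (hint.const_mul M) ?_
  filter_upwards [hbd] with ω h
  rw [sq]
  exact mul_le_mul_of_nonneg_right h.2 h.1

/-- A sum of independent variables in `[0, M]` is rarely much smaller than half of its mean. -/
lemma pi_real_sum_le (hY : Measurable Y) (hM : 0 < M) (hbd : ∀ᵐ ω ∂μ, 0 ≤ Y ω ∧ Y ω ≤ M)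
    (n : ℕ) (t : ℝ) :
    (Measure.pi fun _ : Fin n => μ).real {S | ∑ i, Y (S i) ≤ n * ((∫ ω, Y ω ∂μ) / 2 - t)} ≤
      Real.exp (-(n * t / (2 * M))) := by
  have h := pi_real_mul_le_exp hY (c := -(1 / (2 * M))) (by
    filter_upwards [hbd] with ω h
    rw [abs_mul, abs_neg, abs_of_pos (by positivity), abs_of_nonneg h.1, one_div_mul_eq_div,
      div_le_one (by positivity)]
    linarith) (integral_sq_le_of_bound hY hbd) n
    (-(1 / (2 * M)) * (n * ((∫ ω, Y ω ∂μ) / 2 - t)))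
  have hset : {S : Fin n → Ω | ∑ i, Y (S i) ≤ n * ((∫ ω, Y ω ∂μ) / 2 - t)} =
      {S | -(1 / (2 * M)) * (n * ((∫ ω, Y ω ∂μ) / 2 - t)) ≤ -(1 / (2 * M)) * ∑ i, Y (S i)} := by
    ext S
    have : 0 < 1 / (2 * M) := by positivity
    simp only [Set.mem_ofPred_eq, neg_mul, neg_le_neg_iff, mul_le_mul_iff_right₀ this]
  rw [hset]
  refine h.trans (Real.exp_le_exp.2 (le_of_eq ?_))
  field_simp
  ring

/-- A sum of independent variables in `[0, M]` is rarely much larger than twice its mean. -/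
lemma pi_real_le_sum (hY : Measurable Y) (hM : 0 < M) (hbd : ∀ᵐ ω ∂μ, 0 ≤ Y ω ∧ Y ω ≤ M)
    (n : ℕ) (t : ℝ) :
    (Measure.pi fun _ : Fin n => μ).real {S | n * (2 * (∫ ω, Y ω ∂μ) + t) ≤ ∑ i, Y (S i)} ≤
      Real.exp (-(n * t / (2 * M))) := by
  have h := pi_real_mul_le_exp hY (c := 1 / (2 * M)) (by
    filter_upwards [hbd] with ω h
    rw [abs_mul, abs_of_pos (by positivity), abs_of_nonneg h.1, one_div_mul_eq_div,
      div_le_one (by positivity)]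
    linarith) (integral_sq_le_of_bound hY hbd) n
    (1 / (2 * M) * (n * (2 * (∫ ω, Y ω ∂μ) + t)))
  have hset : {S : Fin n → Ω | n * (2 * (∫ ω, Y ω ∂μ) + t) ≤ ∑ i, Y (S i)} =
      {S | 1 / (2 * M) * (n * (2 * (∫ ω, Y ω ∂μ) + t)) ≤ 1 / (2 * M) * ∑ i, Y (S i)} := by
    ext S
    have : 0 < 1 / (2 * M) := by positivity
    simp only [Set.mem_ofPred_eq, mul_le_mul_iff_right₀ this]
  rw [hset]
  refine h.trans (Real.exp_le_exp.2 ?_)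
  have hmean : 0 ≤ ∫ ω, Y ω ∂μ := integral_nonneg_of_ae (hbd.mono fun ω h => h.1)
  have e : n * (1 / (2 * M) * ∫ ω, Y ω ∂μ + (1 / (2 * M)) ^ 2 * (M * ∫ ω, Y ω ∂μ)) -
      1 / (2 * M) * (n * (2 * (∫ ω, Y ω ∂μ) + t)) =
      -(n * t / (2 * M)) - n * (∫ ω, Y ω ∂μ) / (4 * M) := by
    field_simp
    ring
  rw [e]
  have : 0 ≤ n * (∫ ω, Y ω ∂μ) / (4 * M) := by positivity
  linarith

/-- Bernstein's inequality for a sum of independent variables in `[0, M]` with second moment at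
most `V`. -/
lemma pi_real_abs_sub_mean_ge_le (hY : Measurable Y) (hM : 0 < M)
    (hbd : ∀ᵐ ω ∂μ, 0 ≤ Y ω ∧ Y ω ≤ M) {V ε : ℝ} (hV : ∫ ω, Y ω ^ 2 ∂μ ≤ V) (hε : 0 < ε) (n : ℕ) :
    (Measure.pi fun _ : Fin n => μ).real
        {S | n * (ε / 2) ≤ |∑ i, Y (S i) - n * ∫ ω, Y ω ∂μ|} ≤
      2 * Real.exp (-(n * ε ^ 2 / (4 * (4 * V + M * ε)))) := by
  have hV0 : 0 ≤ V := (integral_nonneg fun ω => sq_nonneg _).trans hV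
  set D : ℝ := 4 * V + M * ε with hD
  have hD0 : 0 < D := by positivity
  set c : ℝ := ε / D with hc
  have hc0 : 0 < c := by positivity
  have hcM : c * M ≤ 1 := by
    rw [hc, div_mul_eq_mul_div, div_le_one hD0, hD]
    linarith
  have hcV : c * V ≤ ε / 4 := by
    rw [hc, div_mul_eq_mul_div, div_le_div_iff₀ hD0 (by norm_num), hD]
    nlinarith [mul_pos hM hε]
  have hsmall : ∀ᵐ ω ∂μ, |c * Y ω| ≤ 1 := by
    filter_upwards [hbd] with ω h
    rw [abs_mul, abs_of_pos hc0, abs_of_nonneg h.1]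
    exact (mul_le_mul_of_nonneg_left h.2 hc0.le).trans hcM
  set A : ℝ := ∫ ω, Y ω ∂μ
  have h1 := pi_real_mul_le_exp hY hsmall hV n (c * (n * (A + ε / 2)))
  have h2 := pi_real_mul_le_exp hY (c := -c) (by simpa only [neg_mul, abs_neg] using hsmall) hV n
    (-c * (n * (A - ε / 2)))
  have key : ∀ x : ℝ, x = n * (c * (c * V - ε / 2)) →
      Real.exp x ≤ Real.exp (-(n * ε ^ 2 / (4 * D))) := by
    intro x hx
    rw [hx]
    refine Real.exp_le_exp.2 ?_
    have e : -(n * ε ^ 2 / (4 * D)) = n * (c * (ε / 4 - ε / 2)) := by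
      rw [hc]
      field_simp
      ring
    rw [e]
    gcongr
  have hsub : {S : Fin n → Ω | n * (ε / 2) ≤ |∑ i, Y (S i) - n * A|} ⊆
      {S | c * (n * (A + ε / 2)) ≤ c * ∑ i, Y (S i)} ∪
        {S | -c * (n * (A - ε / 2)) ≤ -c * ∑ i, Y (S i)} := by
    intro S hS
    rcases le_abs.1 (show n * (ε / 2) ≤ |∑ i, Y (S i) - n * A| from hS) with h | h
    · refine Or.inl (mul_le_mul_of_nonneg_left ?_ hc0.le)
      linarith
    · refine Or.inr ?_
      rw [Set.mem_ofPred_eq, neg_mul, neg_mul, neg_le_neg_iff]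
      refine mul_le_mul_of_nonneg_left ?_ hc0.le
      linarith
  refine (measureReal_mono hsub).trans ((measureReal_union_le _ _).trans ?_)
  have h1' := h1.trans (key _ (by ring))
  have h2' := h2.trans (key _ (by ring))
  linarith

end Concentration

/-! ### The law of one round -/

lemma obsReward_observe {X : Type*} {K m : ℕ} (z : X × (Fin K → ℝ)) (a : Action K m) (y : Fin K) :
    obsReward (observe z a) y = hit a y * z.2 y := by
  by_cases h : y ∈ a.1 <;> simp [obsReward, observe, hit, h]

section Round

variable {X : Type*} [MeasurableSpace X] {K m : ℕ} {D : Measure (X × (Fin K → ℝ))}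
  {α : X → Measure (Action K m)}

lemma measurable_observe (a : Action K m) :
    Measurable fun z : X × (Fin K → ℝ) => observe z a := by
  refine measurable_fst.prodMk (measurable_const.prodMk (measurable_pi_lambda _ fun y => ?_))
  by_cases h : y ∈ a.1
  · simp only [h, if_true]
    exact (measurable_pi_apply y).comp measurable_snd
  · simp only [h, if_false]
    exact measurable_const

lemma measurable_map_observe (hα : Measurable α) :
    Measurable fun z : X × (Fin K → ℝ) => (α z.1).map (observe z) := by
  refine Measure.measurable_of_measurable_coe _ fun s hs => ?_
  have : (fun z : X × (Fin K → ℝ) => (α z.1).map (observe z) s) =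
      fun z => ∑ a, s.indicator 1 (observe z a) * α z.1 {a} := by
    ext z
    rw [Measure.map_apply (measurable_of_countable _) hs, ← lintegral_indicator_one
      (DiscreteMeasurableSpace.forall_measurableSet _), lintegral_fintype]
    rfl
  rw [this]
  refine Finset.measurable_sum _ fun a _ => Measurable.mul ?_ ?_
  · exact (measurable_one.indicator hs).comp (measurable_observe a)
  · exact (Measure.measurable_coe (DiscreteMeasurableSpace.forall_measurableSet {a})).comp
      (hα.comp measurable_fst)

lemma isProbabilityMeasure_roundLaw [IsProbabilityMeasure D] (hα : Measurable α)
    (hα1 : ∀ x, IsProbabilityMeasure (α x)) : IsProbabilityMeasure (roundLaw D α) :=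
  isProbabilityMeasure_bind (measurable_map_observe hα).aemeasurable
    (Filter.Eventually.of_forall fun z =>
      have := hα1 z.1
      Measure.isProbabilityMeasure_map (measurable_of_countable _).aemeasurable)

lemma ae_roundLaw (hα : Measurable α) {P : Obs X K m → Prop} (hP : MeasurableSet {o | P o})
    (h : ∀ᵐ z ∂D, ∀ a, P (observe z a)) : ∀ᵐ o ∂(roundLaw D α), P o := by
  rw [ae_iff, show {o | ¬ P o} = {o | P o}ᶜ from rfl, roundLaw,
    Measure.bind_apply hP.compl (measurable_map_observe hα).aemeasurable]
  refine (lintegral_eq_zero_iff' ((Measure.measurable_coe hP.compl).comp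
    (measurable_map_observe hα)).aemeasurable).2 ?_
  filter_upwards [h] with z hz
  change (α z.1).map (observe z) {o | P o}ᶜ = 0
  rw [Measure.map_apply (measurable_of_countable _) hP.compl]
  rw [show observe z ⁻¹' {o | P o}ᶜ = ∅ from Set.eq_empty_of_forall_notMem fun a ha => ha (hz a),
    measure_empty]

lemma integral_roundLaw [IsProbabilityMeasure D] (hα : Measurable α) {f : Obs X K m → ℝ}
    (hf : Integrable f (roundLaw D α)) :
    ∫ o, f o ∂(roundLaw D α) = ∫ z, ∫ o, f o ∂((α z.1).map (observe z)) ∂D := by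
  let η : Kernel (X × (Fin K → ℝ)) (Obs X K m) := ⟨_, measurable_map_observe hα⟩
  have e : roundLaw D α = η ∘ₘ D := rfl
  rw [e, Measure.comp_eq_comp_const_apply] at hf ⊢
  rw [Kernel.integral_comp hf]
  rfl

lemma measurable_obsReward (y : Fin K) : Measurable fun o : Obs X K m => obsReward o y := by
  refine Measurable.ite ?_ ((measurable_pi_apply y).comp (measurable_snd.comp measurable_snd))
    measurable_const
  exact (measurable_fst.comp measurable_snd)
    (DiscreteMeasurableSpace.forall_measurableSet {a : Action K m | y ∈ a.1})

/-- The observed rewards, weighted with `w` and summed over the basic actions. -/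
noncomputable def weightedReward (w : X → Fin K → ℝ) (o : Obs X K m) : ℝ :=
  ∑ y, w o.1 y * obsReward o y

lemma measurable_weightedReward {w : X → Fin K → ℝ} (hw : ∀ y, Measurable fun x => w x y) :
    Measurable (weightedReward w : Obs X K m → ℝ) :=
  Finset.measurable_sum _ fun y _ => ((hw y).comp measurable_fst).mul (measurable_obsReward y)

variable {s : ℝ}

lemma ae_obsReward (hα : Measurable α)
    (hD : ∀ᵐ z ∂D, (∀ y, 0 ≤ z.2 y ∧ z.2 y ≤ 1) ∧ ∑ y, z.2 y ≤ s) :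
    ∀ᵐ o ∂(roundLaw D α),
      (∀ y, 0 ≤ obsReward o y ∧ obsReward o y ≤ 1) ∧ ∑ y, obsReward o y ≤ s := by
  refine ae_roundLaw hα ?_ ?_
  · refine MeasurableSet.inter (s₁ := {o : Obs X K m | ∀ y, 0 ≤ obsReward o y ∧ obsReward o y ≤ 1})
      ?_ (measurableSet_le (Finset.measurable_sum _ fun y _ => measurable_obsReward y)
        measurable_const)
    rw [Set.ofPred_forall]
    exact MeasurableSet.iInter fun y => (measurableSet_le measurable_const
      (measurable_obsReward y)).inter (measurableSet_le (measurable_obsReward y) measurable_const)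
  · filter_upwards [hD] with z hz a
    have h1 : ∀ y, hit a y * z.2 y ≤ z.2 y := fun y =>
      mul_le_of_le_one_left (hz.1 y).1 (hit_le_one a y)
    simp only [obsReward_observe]
    exact ⟨fun y => ⟨mul_nonneg (hit_nonneg a y) (hz.1 y).1, (h1 y).trans (hz.1 y).2⟩,
      (Finset.sum_le_sum fun y _ => h1 y).trans hz.2⟩

lemma ae_weightedReward (hα : Measurable α)
    (hD : ∀ᵐ z ∂D, (∀ y, 0 ≤ z.2 y ∧ z.2 y ≤ 1) ∧ ∑ y, z.2 y ≤ s)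
    {w : X → Fin K → ℝ} {W : ℝ} (hW : 0 ≤ W) (hw : ∀ x y, 0 ≤ w x y ∧ w x y ≤ W) :
    ∀ᵐ o ∂(roundLaw D α), 0 ≤ weightedReward w o ∧ weightedReward w o ≤ W * s := by
  filter_upwards [ae_obsReward hα hD] with o ho
  refine ⟨Finset.sum_nonneg fun y _ => mul_nonneg (hw _ _).1 (ho.1 y).1, ?_⟩
  calc weightedReward w o ≤ ∑ y, W * obsReward o y :=
        Finset.sum_le_sum fun y _ => mul_le_mul_of_nonneg_right (hw _ _).2 (ho.1 y).1
    _ ≤ W * s := by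
        rw [← Finset.mul_sum]
        exact mul_le_mul_of_nonneg_left ho.2 hW

lemma integrable_weightedReward [IsProbabilityMeasure D] (hα : Measurable α)
    (hα1 : ∀ x, IsProbabilityMeasure (α x))
    (hD : ∀ᵐ z ∂D, (∀ y, 0 ≤ z.2 y ∧ z.2 y ≤ 1) ∧ ∑ y, z.2 y ≤ s)
    {w : X → Fin K → ℝ} (hwm : ∀ y, Measurable fun x => w x y) {W : ℝ} (hW : 0 ≤ W)
    (hw : ∀ x y, 0 ≤ w x y ∧ w x y ≤ W) : Integrable (weightedReward w) (roundLaw D α) := by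
  have := isProbabilityMeasure_roundLaw (D := D) hα hα1
  refine Integrable.of_bound (measurable_weightedReward hwm).aestronglyMeasurable (W * s) ?_
  filter_upwards [ae_weightedReward hα hD hW hw] with o ho
  rw [Real.norm_eq_abs, abs_of_nonneg ho.1]
  exact ho.2

/-- The mean of a weighted sum of the observed rewards, when `P x y` is the probability that `y` is
played in the context `x`. -/
lemma integral_weightedReward [IsProbabilityMeasure D] (hα : Measurable α)
    (hα1 : ∀ x, IsProbabilityMeasure (α x))
    (hD : ∀ᵐ z ∂D, (∀ y, 0 ≤ z.2 y ∧ z.2 y ≤ 1) ∧ ∑ y, z.2 y ≤ s)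
    {P : X → Fin K → ℝ} (hP : ∀ x y, ∫ a, hit a y ∂(α x) = P x y)
    {w : X → Fin K → ℝ} (hwm : ∀ y, Measurable fun x => w x y) {W : ℝ} (hW : 0 ≤ W)
    (hw : ∀ x y, 0 ≤ w x y ∧ w x y ≤ W) :
    ∫ o, weightedReward w o ∂(roundLaw D α) = ∫ z, ∑ y, w z.1 y * P z.1 y * z.2 y ∂D := by
  rw [integral_roundLaw hα (integrable_weightedReward hα hα1 hD hwm hW hw)]
  congr 1
  ext z
  have := hα1 z.1
  rw [integral_map (measurable_of_countable _).aemeasurable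
    (measurable_weightedReward hwm).aestronglyMeasurable]
  simp only [weightedReward, obsReward_observe]
  rw [integral_finsetSum _ fun y _ => Integrable.of_finite]
  refine Finset.sum_congr rfl fun y _ => ?_
  change ∫ a, w z.1 y * (hit a y * z.2 y) ∂(α z.1) = _
  rw [← hP, integral_const_mul, integral_mul_const]
  ring

end Round

/-! ### The probability of playing a basic action -/

lemma nonempty_action {K m : ℕ} (hmK : m ≤ K) : Nonempty (Action K m) := by
  obtain ⟨a, -, ha⟩ := Finset.exists_subset_card_eq (s := (Finset.univ : Finset (Fin K)))
    (n := m) (by simpa using hmK)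
  exact ⟨⟨a, ha⟩⟩

/-- By symmetry every basic action belongs to the same number of actions. -/
lemma card_mul_sum_hit {K m : ℕ} (y : Fin K) :
    (K : ℝ) * ∑ a : Action K m, hit a y = m * Fintype.card (Action K m) := by
  have hsymm : ∀ y' : Fin K, ∑ a : Action K m, hit a y' = ∑ a : Action K m, hit a y := fun y' => by
    let e : Action K m ≃ Action K m :=
      (Equiv.finsetCongr (Equiv.swap y' y)).subtypeEquiv fun a => by simp
    refine Fintype.sum_equiv e _ _ fun a => ?_
    have : (e a).1 = a.1.map (Equiv.swap y' y).toEmbedding := rfl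
    simp only [hit, this, Finset.mem_map_equiv, Equiv.symm_swap, Equiv.swap_apply_right]
  have h1 : ∑ y' : Fin K, ∑ a : Action K m, hit a y' = K * ∑ a : Action K m, hit a y := by
    simp [hsymm]
  rw [← h1, Finset.sum_comm]
  simp [sum_hit, mul_comm]

lemma integral_hit_uniformOn {K m : ℕ} (hm : 0 < m) (hmK : m ≤ K) (y : Fin K) :
    ∫ a : Action K m, hit a y ∂(uniformOn Set.univ) = (m : ℝ) / K := by
  have := nonempty_action hmK
  have hK : (0 : ℝ) < K := by exact_mod_cast hm.trans_le hmK
  have hcard : (0 : ℝ) < Fintype.card (Action K m) := by exact_mod_cast Fintype.card_pos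
  rw [integral_fintype Integrable.of_finite]
  have h1 : ∀ a : Action K m,
      (uniformOn (Set.univ : Set (Action K m))).real {a} = 1 / Fintype.card (Action K m) := by
    intro a
    rw [measureReal_def, uniformOn_univ, Measure.count_singleton]
    simp
  simp only [h1, smul_eq_mul, ← Finset.mul_sum]
  rw [one_div_mul_eq_div, div_eq_div_iff hcard.ne' hK.ne', mul_comm, card_mul_sum_hit]

section MixLaw

variable {X : Type*} {K m : ℕ} {ι : Type*} [Fintype ι] {pol : ι → X → Action K m} {γ : ℝ}
  {p : ι → ℝ}

lemma isProbabilityMeasure_mixLaw (hmK : m ≤ K) (hγ0 : 0 ≤ γ) (hγ1 : γ ≤ 1)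
    (hp : p ∈ stdSimplex ℝ ι) (x : X) : IsProbabilityMeasure (mixLaw pol γ p x) := by
  have := nonempty_action hmK
  constructor
  simp only [mixLaw, Measure.add_apply, Measure.smul_apply, Measure.finsetSum_apply, measure_univ,
    smul_eq_mul, mul_one]
  rw [← ENNReal.ofReal_sum_of_nonneg fun j _ => hp.1 j, hp.2, ENNReal.ofReal_one, mul_one,
    ← ENNReal.ofReal_add hγ0 (sub_nonneg.2 hγ1)]
  simp

lemma measurable_mixLaw [MeasurableSpace X] (hpol : ∀ j, Measurable (pol j)) :
    Measurable (mixLaw pol γ p) := by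
  refine Measure.measurable_of_measurable_coe _ fun s hs => ?_
  simp only [mixLaw, Measure.add_apply, Measure.smul_apply, Measure.finsetSum_apply, smul_eq_mul]
  refine measurable_const.add (measurable_const.mul (Finset.measurable_sum _ fun j _ =>
    measurable_const.mul ?_))
  exact (Measure.measurable_coe hs).comp (Measure.measurable_dirac.comp (hpol j))

lemma integral_hit_mixLaw (hm : 0 < m) (hmK : m ≤ K) (hγ0 : 0 ≤ γ) (hγ1 : γ ≤ 1)
    (hp : p ∈ stdSimplex ℝ ι) (x : X) (y : Fin K) :
    ∫ a, hit a y ∂(mixLaw pol γ p x) = mixProb pol γ p x y := by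
  have := nonempty_action hmK
  have hint : ∀ (c : ℝ) (μ : Measure (Action K m)) [IsFiniteMeasure μ],
      Integrable (fun a => hit a y) (ENNReal.ofReal c • μ) :=
    fun c μ _ => Integrable.of_finite.smul_measure ENNReal.ofReal_ne_top
  have hfin : ∀ j, IsFiniteMeasure (ENNReal.ofReal (p j) • Measure.dirac (pol j x)) :=
    fun j => Measure.smul_finite _ ENNReal.ofReal_ne_top
  rw [mixLaw, integral_add_measure (hint _ _) (hint _ _),
    integral_smul_measure, integral_smul_measure, integral_finsetSum_measure
      fun j _ => hint _ _, integral_hit_uniformOn hm hmK]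
  simp only [integral_smul_measure, integral_dirac, ENNReal.toReal_ofReal hγ0,
    ENNReal.toReal_ofReal (sub_nonneg.2 hγ1), ENNReal.toReal_ofReal (hp.1 _), smul_eq_mul]
  unfold mixProb coverProb hit
  ring

lemma measurable_hit [MeasurableSpace X] {π : X → Action K m} (hπ : Measurable π) (y : Fin K) :
    Measurable fun x => hit (π x) y :=
  (measurable_of_countable fun a : Action K m => hit a y).comp hπ

lemma measurable_mixProb [MeasurableSpace X] (hpol : ∀ j, Measurable (pol j)) (y : Fin K) :
    Measurable fun x => mixProb pol γ p x y :=
  ((Finset.measurable_sum _ fun j _ =>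
    (measurable_hit (hpol j) y).const_mul (p j)).const_mul (1 - γ)).add measurable_const

end MixLaw

/-! ### The law of the output -/

section Law

variable {X : Type*} [MeasurableSpace X] {K m : ℕ} {ι : Type*} [Fintype ι]
  {pol : ι → X → Action K m} {γ : ℝ} {oracle : ∀ n : ℕ, DataSet X K n → ι}
  {D : Measure (X × (Fin K → ℝ))}

lemma IsERMOracle.measurable_comp (hO : IsERMOracle pol oracle) (n : ℕ) {β : Type*}
    [MeasurableSpace β] (f : ι → β) : Measurable fun S : DataSet X K n => f (oracle n S) := by
  let _ : MeasurableSpace ι := ⊤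
  have h1 : Measurable (oracle n) := measurable_to_countable' fun j => hO.measurable n j
  have h2 : Measurable f := measurable_from_top
  exact h2.comp h1

lemma measurable_ipsReward (hpol : ∀ j, Measurable (pol j)) (p : ι → ℝ) :
    Measurable fun o : Obs X K m => ipsReward pol γ p o :=
  measurable_pi_lambda _ fun y =>
    (measurable_obsReward y).div ((measurable_mixProb hpol y).comp measurable_fst)

lemma measurable_fwData (hpol : ∀ j, Measurable (pol j)) (N : ℕ) (p : ι → ℝ) :
    Measurable fun S : Fin N → Obs X K m => fwData pol γ S p :=
  measurable_pi_lambda _ fun i => (measurable_fst.comp (measurable_pi_apply i)).prodMk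
    (measurable_pi_lambda _ fun y => (((measurable_pi_apply y).comp
      (measurable_ipsReward hpol p)).comp (measurable_pi_apply i)).const_mul _)

/-- The outcome of the Frank–Wolfe phase takes finitely many values, and each of them on a
measurable set, hence every function of it is measurable. -/
lemma measurable_comp_fwIter (hO : IsERMOracle pol oracle) (hpol : ∀ j, Measurable (pol j))
    {β : Type*} [MeasurableSpace β] (Φ : (ι → ℝ) → β) (N : ℕ) (n : ℕ) : ∀ (t : ℕ) (p : ι → ℝ),
    Measurable fun S : Fin N → Obs X K m => Φ (fwIter pol γ oracle S n t p) := by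
  induction n with
  | zero => exact fun t p => measurable_const (a := Φ p)
  | succ n ih =>
    intro t p
    let _ : MeasurableSpace ι := ⊤
    have h1 : Measurable fun q : (Fin N → Obs X K m) × ι =>
        Φ (fwIter pol γ oracle q.1 n (t + 1) (fwStep t p q.2)) :=
      measurable_from_prod_countable_left fun j => ih (t + 1) (fwStep t p j)
    have h2 : Measurable fun S : Fin N → Obs X K m => oracle N (fwData pol γ S p) :=
      (hO.measurable_comp N id).comp (measurable_fwData hpol N p)
    exact h1.comp (measurable_id.prodMk h2)

lemma law_frankWolfe {N : ℕ} (S : Fin N → Obs X K m) (next : (ι → ℝ) → Learner X K m ι) (n : ℕ) :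
    ∀ (t : ℕ) (p : ι → ℝ), (frankWolfe pol γ S next n t p).law D oracle =
      ((next (fwIter pol γ oracle S n t p)).law D oracle).map
        fun o => { o with ermCalls := o.ermCalls + n } := by
  induction n with
  | zero => exact fun t p => Measure.map_id.symm
  | succ n ih =>
    intro t p
    have h := ih (t + 1) (fwStep t p (oracle N (fwData pol γ S p)))
    rw [frankWolfe, Learner.law]
    change ((frankWolfe pol γ S next n (t + 1)
      (fwStep t p (oracle N (fwData pol γ S p)))).law D oracle).map _ = _
    rw [h, Measure.map_map measurable_from_top measurable_from_top, fwIter]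
    rfl

/-- The policy that the oracle selects from the importance-weighted rewards of the second phase. -/
noncomputable def selectedPolicy (pol : ι → X → Action K m) (γ : ℝ)
    (oracle : ∀ n : ℕ, DataSet X K n → ι) (p : ι → ℝ) {N : ℕ} (S : Fin N → Obs X K m) : ι :=
  oracle N fun i => ((S i).1, ipsReward pol γ p (S i))

lemma measurable_comp_selectedPolicy (hO : IsERMOracle pol oracle)
    (hpol : ∀ j, Measurable (pol j)) {β : Type*} [MeasurableSpace β] (f : ι → β) (p : ι → ℝ)
    (N : ℕ) : Measurable fun S : Fin N → Obs X K m => f (selectedPolicy pol γ oracle p S) :=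
  (hO.measurable_comp N f).comp (measurable_pi_lambda _ fun i =>
    (measurable_fst.comp (measurable_pi_apply i)).prodMk
      ((measurable_ipsReward hpol p).comp (measurable_pi_apply i)))

/-- The algorithm is a two-stage experiment: the first sample determines the mixture, and the second
sample, drawn with that mixture, determines the output. -/
lemma law_pacComband (hO : IsERMOracle pol oracle) (hpol : ∀ j, Measurable (pol j))
    (N₁ N₂ T : ℕ) (j₀ : ι) :
    (pacComband pol γ N₁ N₂ T j₀).law D oracle =
      (Measure.pi fun _ : Fin N₁ => roundLaw D fun _ => uniformOn Set.univ).bind fun S₁ =>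
        (Measure.pi fun _ : Fin N₂ =>
          roundLaw D (mixLaw pol γ (fwIter pol γ oracle S₁ T 1 (delta j₀)))).map fun S₂ =>
            ⟨selectedPolicy pol γ oracle (fwIter pol γ oracle S₁ T 1 (delta j₀)) S₂,
              N₁ + N₂, T + 1⟩ := by
  rw [pacComband, Learner.law]
  congr 1
  funext S₁
  rw [law_frankWolfe, Measure.map_map measurable_from_top measurable_from_top]
  set p := fwIter pol γ oracle S₁ T 1 (delta j₀)
  have hsel : Measurable fun S₂ : Fin N₂ → Obs X K m =>
      (⟨selectedPolicy pol γ oracle p S₂, N₂, 1⟩ : Outcome ι) :=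
    measurable_comp_selectedPolicy hO hpol (fun j => (⟨j, N₂, 1⟩ : Outcome ι)) p N₂
  have hinner : (Learner.explore N₂ (mixLaw pol γ p) fun S₂ =>
      .erm N₂ (fun i => ((S₂ i).1, ipsReward pol γ p (S₂ i))) fun j => .output j).law D oracle =
      (Measure.pi fun _ : Fin N₂ => roundLaw D (mixLaw pol γ p)).map fun S₂ =>
        ⟨selectedPolicy pol γ oracle p S₂, N₂, 1⟩ := by
    rw [← Measure.bind_dirac_eq_map _ hsel, Learner.law]
    congr 1
    funext S₂
    rw [Learner.law, Learner.law, Measure.map_dirac' measurable_from_top,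
      Measure.map_dirac' measurable_from_top]
    simp [selectedPolicy]
  rw [hinner, Measure.map_map measurable_from_top hsel]
  congr 1
  funext S₂
  simp [add_comm]

lemma law_pacComband_apply (hO : IsERMOracle pol oracle) (hpol : ∀ j, Measurable (pol j))
    (N₁ N₂ T : ℕ) (j₀ : ι) (E : Set (Outcome ι)) :
    (pacComband pol γ N₁ N₂ T j₀).law D oracle E =
      ∫⁻ S₁, (Measure.pi fun _ : Fin N₂ =>
          roundLaw D (mixLaw pol γ (fwIter pol γ oracle S₁ T 1 (delta j₀))))
            {S₂ | ⟨selectedPolicy pol γ oracle (fwIter pol γ oracle S₁ T 1 (delta j₀)) S₂,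
              N₁ + N₂, T + 1⟩ ∈ E}
        ∂(Measure.pi fun _ : Fin N₁ => roundLaw D fun _ => uniformOn Set.univ) := by
  rw [law_pacComband hO hpol, Measure.bind_apply (DiscreteMeasurableSpace.forall_measurableSet E)]
  · refine lintegral_congr fun S₁ => ?_
    rw [Measure.map_apply (measurable_comp_selectedPolicy hO hpol
      (fun j => (⟨j, N₁ + N₂, T + 1⟩ : Outcome ι)) _ N₂)
      (DiscreteMeasurableSpace.forall_measurableSet E)]
    rfl
  · exact (measurable_comp_fwIter hO hpol (fun p => (Measure.pi fun _ : Fin N₂ =>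
      roundLaw D (mixLaw pol γ p)).map fun S₂ =>
        (⟨selectedPolicy pol γ oracle p S₂, N₁ + N₂, T + 1⟩ : Outcome ι)) N₁ T 1 _).aemeasurable

lemma isProbabilityMeasure_roundLaw_mixLaw [IsProbabilityMeasure D]
    (hpol : ∀ j, Measurable (pol j)) (hmK : m ≤ K) (hγ0 : 0 ≤ γ) (hγ1 : γ ≤ 1) {p : ι → ℝ}
    (hp : p ∈ stdSimplex ℝ ι) : IsProbabilityMeasure (roundLaw D (mixLaw pol γ p)) :=
  isProbabilityMeasure_roundLaw (measurable_mixLaw hpol)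
    (isProbabilityMeasure_mixLaw hmK hγ0 hγ1 hp)

omit [Fintype ι] in
lemma isProbabilityMeasure_roundLaw_uniformOn [IsProbabilityMeasure D] (hmK : m ≤ K) :
    IsProbabilityMeasure (roundLaw (m := m) D fun _ => uniformOn Set.univ) :=
  have := nonempty_action hmK
  isProbabilityMeasure_roundLaw measurable_const fun _ => inferInstance

lemma isProbabilityMeasure_law_pacComband [IsProbabilityMeasure D] (hO : IsERMOracle pol oracle)
    (hpol : ∀ j, Measurable (pol j)) (hmK : m ≤ K) (hγ0 : 0 ≤ γ) (hγ1 : γ ≤ 1)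
    (N₁ N₂ T : ℕ) (j₀ : ι) :
    IsProbabilityMeasure ((pacComband pol γ N₁ N₂ T j₀).law D oracle) := by
  constructor
  have := isProbabilityMeasure_roundLaw_uniformOn (D := D) hmK
  rw [law_pacComband_apply hO hpol]
  have h : ∀ S₁ : Fin N₁ → Obs X K m, IsProbabilityMeasure
      (roundLaw D (mixLaw pol γ (fwIter pol γ oracle S₁ T 1 (delta j₀)))) := fun S₁ =>
    isProbabilityMeasure_roundLaw_mixLaw hpol hmK hγ0 hγ1
      (fwIter_mem_stdSimplex T 1 _ le_rfl (delta_mem_stdSimplex j₀))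
  simp

lemma ae_law_pacComband (hO : IsERMOracle pol oracle) (hpol : ∀ j, Measurable (pol j))
    (N₁ N₂ T : ℕ) (j₀ : ι) :
    ∀ᵐ o ∂((pacComband pol γ N₁ N₂ T j₀).law D oracle),
      o.samples = N₁ + N₂ ∧ o.ermCalls = T + 1 := by
  rw [ae_iff, law_pacComband_apply hO hpol]
  simp

/-- The failure probabilities of the two phases add up. -/
lemma law_pacComband_le [IsProbabilityMeasure D] (hO : IsERMOracle pol oracle)
    (hpol : ∀ j, Measurable (pol j)) (hmK : m ≤ K) (hγ0 : 0 ≤ γ) (hγ1 : γ ≤ 1)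
    (N₁ N₂ T : ℕ) (j₀ : ι) (bad : Set (Fin N₁ → Obs X K m)) {P : ι → Prop} {b : ENNReal}
    (h : ∀ᵐ S₁ ∂(Measure.pi fun _ : Fin N₁ => roundLaw D fun _ => uniformOn Set.univ), S₁ ∉ bad →
      (Measure.pi fun _ : Fin N₂ =>
          roundLaw D (mixLaw pol γ (fwIter pol γ oracle S₁ T 1 (delta j₀))))
        {S₂ | P (selectedPolicy pol γ oracle (fwIter pol γ oracle S₁ T 1 (delta j₀)) S₂)} ≤ b) :
    (pacComband pol γ N₁ N₂ T j₀).law D oracle {o | P o.policy} ≤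
      (Measure.pi fun _ : Fin N₁ => roundLaw D fun _ => uniformOn Set.univ) bad + b := by
  have := isProbabilityMeasure_roundLaw_uniformOn (D := D) hmK
  have hprob : ∀ S₁ : Fin N₁ → Obs X K m, IsProbabilityMeasure
      (roundLaw D (mixLaw pol γ (fwIter pol γ oracle S₁ T 1 (delta j₀)))) := fun S₁ =>
    isProbabilityMeasure_roundLaw_mixLaw hpol hmK hγ0 hγ1
      (fwIter_mem_stdSimplex T 1 _ le_rfl (delta_mem_stdSimplex j₀))
  rw [law_pacComband_apply hO hpol]
  calc _ ≤ ∫⁻ S₁, (bad.indicator 1 S₁ + b)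
        ∂(Measure.pi fun _ : Fin N₁ => roundLaw D fun _ => uniformOn Set.univ) := by
        refine lintegral_mono_ae ?_
        filter_upwards [h] with S₁ h₁
        by_cases hS : S₁ ∈ bad
        · rw [Set.indicator_of_mem hS]
          exact prob_le_one.trans le_self_add
        · rw [Set.indicator_of_notMem hS, zero_add]
          exact h₁ hS
    _ ≤ _ := by
        rw [lintegral_add_right _ measurable_const, lintegral_const, measure_univ, mul_one]
        gcongr
        exact lintegral_indicator_one_le bad

end Law

/-! ### Importance weights -/

section Weights

variable {X : Type*} {K m : ℕ} {ι : Type*} [Fintype ι] {pol : ι → X → Action K m} {γ : ℝ}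
  {p : ι → ℝ}

/-- The importance weight `𝟙[y ∈ π(x)] / Q_p^γ(x, y)` of the policy `j`. -/
noncomputable def ipsWeight (pol : ι → X → Action K m) (γ : ℝ) (p : ι → ℝ) (j : ι) (x : X)
    (y : Fin K) : ℝ :=
  hit (pol j x) y / mixProb pol γ p x y

lemma ipsWeight_nonneg (hγ0 : 0 ≤ γ) (hγ1 : γ ≤ 1) (hp : p ∈ stdSimplex ℝ ι) (j : ι) (x : X)
    (y : Fin K) : 0 ≤ ipsWeight pol γ p j x y :=
  div_nonneg (hit_nonneg _ _) ((by positivity : 0 ≤ γ * m / K).trans (le_mixProb hγ1 hp x y))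

lemma ipsWeight_le (hg : 0 < γ * m / K) (hγ1 : γ ≤ 1) (hp : p ∈ stdSimplex ℝ ι) (j : ι) (x : X)
    (y : Fin K) : ipsWeight pol γ p j x y ≤ 1 / (γ * m / K) :=
  div_le_div₀ zero_le_one (hit_le_one _ _) hg (le_mixProb hγ1 hp x y)

lemma measurable_ipsWeight [MeasurableSpace X] (hpol : ∀ j, Measurable (pol j)) (j : ι)
    (y : Fin K) : Measurable fun x => ipsWeight pol γ p j x y :=
  (measurable_hit (hpol j) y).div (measurable_mixProb hpol y)

lemma sum_hit_mul_ipsReward (j : ι) (o : Obs X K m) :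
    ∑ y, hit (pol j o.1) y * ipsReward pol γ p o y = weightedReward (ipsWeight pol γ p j) o := by
  refine Finset.sum_congr rfl fun y _ => ?_
  change hit (pol j o.1) y * (obsReward o y / mixProb pol γ p o.1 y) = _
  rw [ipsWeight]
  ring

/-- The uniform mixture of the policies in a list. -/
noncomputable def uniformMixture {k : ℕ} (J : Fin k → ι) : ι → ℝ := fun j =>
  (∑ i, delta (J i) j) / k

lemma uniformMixture_mem_stdSimplex {k : ℕ} (hk : 0 < k) (J : Fin k → ι) :
    uniformMixture J ∈ stdSimplex ℝ ι := by
  have hk' : (k : ℝ) ≠ 0 := by exact_mod_cast hk.ne'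
  refine ⟨fun j => div_nonneg (Finset.sum_nonneg fun i _ => (delta_mem_stdSimplex (J i)).1 j)
    k.cast_nonneg, ?_⟩
  simp only [uniformMixture]
  rw [← Finset.sum_div, Finset.sum_comm]
  simp [(delta_mem_stdSimplex _).2, hk']

lemma mixProb_uniformMixture {k : ℕ} (J : Fin k → ι) (x : X) (y : Fin K) :
    mixProb pol γ (uniformMixture J) x y =
      (1 - γ) * ((∑ i, hit (pol (J i) x) y) / k) + γ * m / K := by
  have h : coverProb pol (uniformMixture J) x y = (∑ i, hit (pol (J i) x) y) / k := by
    simp only [← coverProb_delta, coverProb, uniformMixture, div_mul_eq_mul_div,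
      Finset.sum_mul, ← Finset.sum_div]
    rw [Finset.sum_comm]
  rw [mixProb, h]

/-- The importance weights of a mixture agree, up to a factor of two, with the average of the
importance weights of the uniform mixtures of `k` policies drawn from it. -/
lemma ipsWeight_le_uniformMixture (hg : 0 < γ * m / K) (hγ0 : 0 ≤ γ) (hγ1 : γ ≤ 1)
    (hp : p ∈ stdSimplex ℝ ι) {k : ℕ} (hk : 1 / (γ * m / K) ≤ k) (j : ι) (x : X) (y : Fin K) :
    ipsWeight pol γ p j x y ≤
      ∑ J : Fin k → ι, (∏ i, p (J i)) * ipsWeight pol γ (uniformMixture J) j x y ∧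
    ∑ J : Fin k → ι, (∏ i, p (J i)) * ipsWeight pol γ (uniformMixture J) j x y ≤
      2 * ipsWeight pol γ p j x y := by
  obtain ⟨h1, h2⟩ := inv_le_iid_average hp (fun j => hit_eq_zero_or_one (pol j x) y)
    (sub_nonneg.2 hγ1) (by linarith) hg hk
  have e1 : mixProb pol γ p x y = (1 - γ) * ∑ j, p j * hit (pol j x) y + γ * m / K := rfl
  rw [← e1] at h1 h2
  simp only [← mixProb_uniformMixture] at h1 h2
  have e2 : ∑ J : Fin k → ι, (∏ i, p (J i)) * ipsWeight pol γ (uniformMixture J) j x y =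
      hit (pol j x) y *
        ∑ J : Fin k → ι, (∏ i, p (J i)) * (1 / mixProb pol γ (uniformMixture J) x y) := by
    rw [Finset.mul_sum]
    refine Finset.sum_congr rfl fun J _ => ?_
    rw [ipsWeight]
    ring
  have e3 : ipsWeight pol γ p j x y = hit (pol j x) y * (1 / mixProb pol γ p x y) := by
    rw [ipsWeight]
    ring
  rw [e2, e3]
  refine ⟨mul_le_mul_of_nonneg_left h1 (hit_nonneg _ _), ?_⟩
  have := mul_le_mul_of_nonneg_left h2 (hit_nonneg (pol j x) y)
  linarith

end Weights

section Moment

variable {X : Type*} [MeasurableSpace X] {K m : ℕ} {ι : Type*} [Fintype ι]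
  {pol : ι → X → Action K m} {γ : ℝ} {p : ι → ℝ} {D : Measure (X × (Fin K → ℝ))} {s : ℝ}

/-- The expectation of `∑_{y ∈ π(x)} r(y) / Q_p^γ(x, y)` for the policy `π` with index `j`, which up
to the factor `m` bounds the second moment of the reward estimate of `π`. -/
noncomputable def ipsMoment (D : Measure (X × (Fin K → ℝ))) (pol : ι → X → Action K m) (γ : ℝ)
    (p : ι → ℝ) (j : ι) : ℝ :=
  ∫ z, ∑ y, ipsWeight pol γ p j z.1 y * z.2 y ∂D

lemma integrable_ipsMoment [IsProbabilityMeasure D] (hpol : ∀ j, Measurable (pol j))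
    (hg : 0 < γ * m / K) (hγ0 : 0 ≤ γ) (hγ1 : γ ≤ 1) (hp : p ∈ stdSimplex ℝ ι)
    (hD : ∀ᵐ z ∂D, (∀ y, 0 ≤ z.2 y ∧ z.2 y ≤ 1) ∧ ∑ y, z.2 y ≤ s) (j : ι) :
    Integrable (fun z => ∑ y, ipsWeight pol γ p j z.1 y * z.2 y) D := by
  refine Integrable.of_bound (Finset.measurable_sum _ fun y _ =>
    ((measurable_ipsWeight hpol j y).comp measurable_fst).mul
      ((measurable_pi_apply y).comp measurable_snd)).aestronglyMeasurable
    (∑ _ : Fin K, 1 / (γ * m / K)) ?_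
  filter_upwards [hD] with z hz
  rw [Real.norm_eq_abs, abs_of_nonneg (Finset.sum_nonneg fun y _ =>
    mul_nonneg (ipsWeight_nonneg hγ0 hγ1 hp j _ y) (hz.1 y).1)]
  refine Finset.sum_le_sum fun y _ => ?_
  exact (mul_le_of_le_one_right (ipsWeight_nonneg hγ0 hγ1 hp j _ y) (hz.1 y).2).trans
    (ipsWeight_le hg hγ1 hp j _ y)

lemma ipsMoment_le_uniformMixture [IsProbabilityMeasure D] (hpol : ∀ j, Measurable (pol j))
    (hg : 0 < γ * m / K) (hγ0 : 0 ≤ γ) (hγ1 : γ ≤ 1) (hp : p ∈ stdSimplex ℝ ι)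
    (hD : ∀ᵐ z ∂D, (∀ y, 0 ≤ z.2 y ∧ z.2 y ≤ 1) ∧ ∑ y, z.2 y ≤ s) {k : ℕ} (hk0 : 0 < k)
    (hk : 1 / (γ * m / K) ≤ k) (j : ι) :
    ipsMoment D pol γ p j ≤
      ∑ J : Fin k → ι, (∏ i, p (J i)) * ipsMoment D pol γ (uniformMixture J) j := by
  have hint := fun J : Fin k → ι => (integrable_ipsMoment hpol hg hγ0 hγ1
    (uniformMixture_mem_stdSimplex hk0 J) hD j).const_mul (∏ i, p (J i))
  simp only [ipsMoment, ← integral_const_mul]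
  rw [← integral_finsetSum _ fun J _ => hint J]
  refine integral_mono_ae (integrable_ipsMoment hpol hg hγ0 hγ1 hp hD j)
    (integrable_finsetSum _ fun J _ => hint J) ?_
  filter_upwards [hD] with z hz
  simp only [Finset.mul_sum]
  rw [Finset.sum_comm]
  refine Finset.sum_le_sum fun y _ => ?_
  simp only [← mul_assoc, ← Finset.sum_mul]
  exact mul_le_mul_of_nonneg_right
    (ipsWeight_le_uniformMixture hg hγ0 hγ1 hp hk j z.1 y).1 (hz.1 y).1

/-- A lower bound on the reward estimates that holds for all uniform mixtures of `k` policies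
extends to all mixtures. -/
lemma ipsMoment_le_of_uniformMixture [IsProbabilityMeasure D] (hpol : ∀ j, Measurable (pol j))
    (hg : 0 < γ * m / K) (hγ0 : 0 ≤ γ) (hγ1 : γ ≤ 1) (hp : p ∈ stdSimplex ℝ ι)
    (hD : ∀ᵐ z ∂D, (∀ y, 0 ≤ z.2 y ∧ z.2 y ≤ 1) ∧ ∑ y, z.2 y ≤ s) {k : ℕ} (hk0 : 0 < k)
    (hk : 1 / (γ * m / K) ≤ k) (j : ι) {N : ℕ} {S : Fin N → Obs X K m}
    (hS : ∀ i y, 0 ≤ obsReward (S i) y) {A B : ℝ} (hA : 0 ≤ A)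
    (h : ∀ J : Fin k → ι, A * ipsMoment D pol γ (uniformMixture J) j - B ≤
      ∑ i, weightedReward (ipsWeight pol γ (uniformMixture J) j) (S i)) :
    A * ipsMoment D pol γ p j - B ≤
      2 * ∑ i, weightedReward (ipsWeight pol γ p j) (S i) := by
  have hw : ∀ J : Fin k → ι, 0 ≤ ∏ i, p (J i) := fun J => Finset.prod_nonneg fun i _ => hp.1 _
  have hw1 : ∑ J : Fin k → ι, ∏ i, p (J i) = 1 :=
    (iid_sum_moments hp.2 (f := fun _ => 0) (by simp) k).1
  calc A * ipsMoment D pol γ p j - B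
      ≤ A * ∑ J : Fin k → ι, (∏ i, p (J i)) * ipsMoment D pol γ (uniformMixture J) j - B := by
        have := mul_le_mul_of_nonneg_left
          (ipsMoment_le_uniformMixture hpol hg hγ0 hγ1 hp hD hk0 hk j) hA
        linarith
    _ = ∑ J : Fin k → ι, (∏ i, p (J i)) *
          (A * ipsMoment D pol γ (uniformMixture J) j - B) := by
        simp only [mul_sub, Finset.sum_sub_distrib, ← Finset.sum_mul, hw1, one_mul, Finset.mul_sum]
        congr 1
        exact Finset.sum_congr rfl fun J _ => by ring
    _ ≤ ∑ J : Fin k → ι, (∏ i, p (J i)) *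
          ∑ i, weightedReward (ipsWeight pol γ (uniformMixture J) j) (S i) :=
        Finset.sum_le_sum fun J _ => mul_le_mul_of_nonneg_left (h J) (hw J)
    _ = ∑ i, ∑ y, (∑ J : Fin k → ι, (∏ i, p (J i)) *
          ipsWeight pol γ (uniformMixture J) j (S i).1 y) * obsReward (S i) y := by
        simp only [weightedReward, Finset.mul_sum, Finset.sum_mul]
        rw [Finset.sum_comm]
        refine Finset.sum_congr rfl fun i _ => ?_
        rw [Finset.sum_comm]
        exact Finset.sum_congr rfl fun y _ => Finset.sum_congr rfl fun J _ => by ring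
    _ ≤ ∑ i, ∑ y, (2 * ipsWeight pol γ p j (S i).1 y) * obsReward (S i) y :=
        Finset.sum_le_sum fun i _ => Finset.sum_le_sum fun y _ => mul_le_mul_of_nonneg_right
          (ipsWeight_le_uniformMixture hg hγ0 hγ1 hp hk j _ y).2 (hS i y)
    _ = _ := by simp only [weightedReward, Finset.mul_sum, mul_assoc]

/-- After the first phase, with high probability every policy has a reward estimate of small second
moment under the mixture that Frank–Wolfe has found. -/
lemma phase_one [IsProbabilityMeasure D] {oracle : ∀ n : ℕ, DataSet X K n → ι}
    (hO : IsERMOracle pol oracle) (hpol : ∀ j, Measurable (pol j)) (hm : 0 < m) (hmK : m ≤ K)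
    (hs : 0 < s) (hD : ∀ᵐ z ∂D, (∀ y, 0 ≤ z.2 y ∧ z.2 y ≤ 1) ∧ ∑ y, z.2 y ≤ s)
    {N T : ℕ} (hN : 0 < N) (hT : 256 * ((K : ℝ) / m) ^ 3 ≤ T) (j₀ : ι) :
    ∃ bad : Set (Fin N → Obs X K m),
      (Measure.pi fun _ : Fin N => roundLaw D fun _ => uniformOn Set.univ).real bad ≤
        Real.exp (-(N * (m / K) / 2)) +
          (Fintype.card ι : ℝ) ^ (2 * K + 1) * Real.exp (-(N * (m / K) ^ 2 / 4)) ∧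
      ∀ᵐ S ∂(Measure.pi fun _ : Fin N => roundLaw D fun _ => uniformOn Set.univ), S ∉ bad →
        ∀ j, ipsMoment D pol (1 / 2) (fwIter pol (1 / 2) oracle S T 1 (delta j₀)) j ≤ 122 * s := by
  have hK : (0 : ℝ) < K := by exact_mod_cast hm.trans_le hmK
  have hm' : (0 : ℝ) < m := by exact_mod_cast hm
  have hm1 : (1 : ℝ) ≤ m := by exact_mod_cast hm
  have hN' : (0 : ℝ) < N := by exact_mod_cast hN
  have hne := nonempty_action hmK
  set α : X → Measure (Action K m) := fun _ => uniformOn Set.univ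
  have hα : Measurable α := measurable_const
  have hα1 : ∀ x, IsProbabilityMeasure (α x) := fun _ => by
    change IsProbabilityMeasure (uniformOn Set.univ)
    infer_instance
  have hP : ∀ (x : X) y, ∫ a, hit a y ∂(α x) = (fun _ _ => (m : ℝ) / K : X → Fin K → ℝ) x y :=
    fun _ y => integral_hit_uniformOn hm hmK y
  have hround := isProbabilityMeasure_roundLaw (D := D) hα hα1
  set g : ℝ := 1 / 2 * m / K with hgdef
  have hg : 0 < g := by positivity
  have hk0 : 0 < 2 * K := by have := hm.trans_le hmK; omega
  have hk : 1 / g ≤ (2 * K : ℕ) := by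
    rw [hgdef, div_le_iff₀ (by positivity)]
    push_cast
    field_simp
    exact hm1
  have h12 : (0 : ℝ) ≤ 1 / 2 := by norm_num
  have h121 : (1 / 2 : ℝ) ≤ 1 := by norm_num
  have hmean1 : ∫ o, weightedReward (fun _ _ => 1) o ∂(roundLaw D α) ≤ s * (m / K) := by
    rw [integral_weightedReward hα hα1 hD hP (fun _ => measurable_const) zero_le_one
      fun _ _ => ⟨zero_le_one, le_rfl⟩]
    calc _ ≤ ∫ _, s * (m / K) ∂D := by
          refine integral_mono_of_nonneg ?_ (integrable_const _) ?_
          · filter_upwards [hD] with z hz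
            exact Finset.sum_nonneg fun y _ => mul_nonneg (by positivity) (hz.1 y).1
          · filter_upwards [hD] with z hz
            simp only [one_mul, ← Finset.mul_sum]
            rw [mul_comm]
            exact mul_le_mul_of_nonneg_right hz.2 (by positivity)
      _ = _ := by simp
  have hmeanJ : ∀ (J : Fin (2 * K) → ι) (j : ι),
      ∫ o, weightedReward (ipsWeight pol (1 / 2) (uniformMixture J) j) o ∂(roundLaw D α) =
        m / K * ipsMoment D pol (1 / 2) (uniformMixture J) j := fun J j => by
    have hp := uniformMixture_mem_stdSimplex hk0 J
    rw [integral_weightedReward hα hα1 hD hP (measurable_ipsWeight hpol j)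
      (one_div_pos.2 hg).le fun x y =>
        ⟨ipsWeight_nonneg h12 h121 hp j x y, ipsWeight_le hg h121 hp j x y⟩, ipsMoment,
      ← integral_const_mul]
    refine integral_congr_ae (Filter.Eventually.of_forall fun z => ?_)
    simp only [Finset.mul_sum]
    exact Finset.sum_congr rfl fun y _ => by ring
  -- The good event: the total observed reward is at most three times the bound `s * m / K` on its
  -- mean, and the reward estimates under uniform mixtures of `2 * K` policies are not too small.
  -- There are only `card ι ^ (2 * K)` such mixtures, which is what makes a union bound possible
  -- although the mixture found by Frank–Wolfe depends on the data.
  set bad₁ : Set (Fin N → Obs X K m) := {S | N * (2 * (∫ o, weightedReward (fun _ _ => 1) o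
    ∂(roundLaw D α)) + s * (m / K)) ≤ ∑ i, weightedReward (fun _ _ => 1) (S i)}
  set badJ : (Fin (2 * K) → ι) × ι → Set (Fin N → Obs X K m) := fun q =>
    {S | ∑ i, weightedReward (ipsWeight pol (1 / 2) (uniformMixture q.1) q.2) (S i) ≤
      N * ((∫ o, weightedReward (ipsWeight pol (1 / 2) (uniformMixture q.1) q.2) o
        ∂(roundLaw D α)) / 2 - s * (m / K))}
  have hbad1 : (Measure.pi fun _ : Fin N => roundLaw D α).real bad₁ ≤
      Real.exp (-(N * (m / K) / 2)) := by
    refine (pi_real_le_sum (measurable_weightedReward fun _ => measurable_const)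
      (mul_pos one_pos hs) (ae_weightedReward hα hD zero_le_one fun _ _ =>
        ⟨zero_le_one, le_rfl⟩) N (s * (m / K))).trans (le_of_eq ?_)
    congr 1
    field_simp
  have hbadJ : ∀ q, (Measure.pi fun _ : Fin N => roundLaw D α).real (badJ q) ≤
      Real.exp (-(N * (m / K) ^ 2 / 4)) := fun q => by
    have hp := uniformMixture_mem_stdSimplex hk0 q.1
    refine (pi_real_sum_le (measurable_weightedReward (measurable_ipsWeight hpol q.2))
      (mul_pos (one_div_pos.2 hg) hs) (ae_weightedReward hα hD (one_div_pos.2 hg).le fun x y =>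
        ⟨ipsWeight_nonneg h12 h121 hp q.2 x y, ipsWeight_le hg h121 hp q.2 x y⟩)
      N (s * (m / K))).trans (le_of_eq ?_)
    congr 1
    rw [hgdef]
    field_simp
    ring
  refine ⟨bad₁ ∪ ⋃ q, badJ q, ?_, ?_⟩
  · refine (measureReal_union_le _ _).trans (add_le_add hbad1 ?_)
    refine (measureReal_iUnion_fintype_le _).trans
      ((Finset.sum_le_sum fun q _ => hbadJ q).trans (le_of_eq ?_))
    simp [Finset.card_univ, pow_succ]
  · have hae : ∀ᵐ S ∂(Measure.pi fun _ : Fin N => roundLaw D α),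
        ∀ i y, 0 ≤ obsReward (S i) y := by
      rw [Filter.eventually_all]
      intro i
      filter_upwards [(Measure.tendsto_eval_ae_ae (μ := fun _ : Fin N => roundLaw D α)
        (i := i)).eventually (ae_obsReward hα hD)] with S h y
      exact (h.1 y).1
    filter_upwards [hae] with S hS hgood j
    simp only [Set.mem_union, Set.mem_iUnion, not_or, not_exists] at hgood
    obtain ⟨hg1, hgJ⟩ := hgood
    set p := fwIter pol (1 / 2) oracle S T 1 (delta j₀)
    have hp : p ∈ stdSimplex ℝ ι := fwIter_mem_stdSimplex T 1 _ le_rfl (delta_mem_stdSimplex j₀)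
    have hfw := fwIter_ipsReward_le hO hN hm hmK (γ := 1 / 2) (by norm_num) (by norm_num) hS
      (T := T) (by
        refine le_trans (le_of_eq ?_) hT
        field_simp
        norm_num) j₀ j
    simp only [sum_hit_mul_ipsReward] at hfw
    have htot : ∑ i, ∑ y, obsReward (S i) y ≤ N * (3 * (s * (m / K))) := by
      have h1 : ∑ i, weightedReward (fun _ _ => 1) (S i) ≤
          N * (2 * (∫ o, weightedReward (fun _ _ => 1) o ∂(roundLaw D α)) + s * (m / K)) :=
        (lt_of_not_ge fun h => hg1 h).le
      simp only [weightedReward, one_mul] at h1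
      refine h1.trans (mul_le_mul_of_nonneg_left ?_ hN'.le)
      simp only [weightedReward, one_mul] at hmean1
      linarith
    have hlow := ipsMoment_le_of_uniformMixture (A := N * (m / K) / 2) (B := N * (s * (m / K)))
      hpol hg h12 h121 hp hD hk0 hk j hS (by positivity) (fun J => by
        have h1 : N * ((∫ o, weightedReward (ipsWeight pol (1 / 2) (uniformMixture J) j) o
              ∂(roundLaw D α)) / 2 - s * (m / K)) ≤
            ∑ i, weightedReward (ipsWeight pol (1 / 2) (uniformMixture J) j) (S i) :=
          (lt_of_not_ge fun h => hgJ (J, j) h).le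
        simp only [hmeanJ] at h1
        refine le_trans (le_of_eq ?_) h1
        ring)
    -- Frank–Wolfe gives at most `5 / (1 - γ) = 10` times the total observed reward, and passing to
    -- uniform mixtures costs a factor of two; together `A * M ≤ 20 * 3 * 2 * A * s + 2 * A * s`.
    have hA : 0 < N * ((m : ℝ) / K) / 2 := by positivity
    have hfinal : N * ((m : ℝ) / K) / 2 * ipsMoment D pol (1 / 2) p j ≤
        N * ((m : ℝ) / K) / 2 * (122 * s) := by
      have e : N * ((m : ℝ) / K) / 2 * (122 * s) =
          20 * (N * (3 * (s * (m / K)))) + N * (s * (m / K)) := by ring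
      rw [e]
      linarith
    exact le_of_mul_le_mul_left hfinal hA

/-- The reward estimates of the second phase are unbiased. -/
lemma integral_weightedReward_ipsWeight [IsProbabilityMeasure D] (hpol : ∀ j, Measurable (pol j))
    (hm : 0 < m) (hmK : m ≤ K) (hγ0 : 0 < γ) (hγ1 : γ ≤ 1) (hp : p ∈ stdSimplex ℝ ι)
    (hD : ∀ᵐ z ∂D, (∀ y, 0 ≤ z.2 y ∧ z.2 y ≤ 1) ∧ ∑ y, z.2 y ≤ s) (j : ι) :
    ∫ o, weightedReward (ipsWeight pol γ p j) o ∂(roundLaw D (mixLaw pol γ p)) =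
      policyReward D (pol j) := by
  have hK : (0 : ℝ) < K := by exact_mod_cast hm.trans_le hmK
  have hm' : (0 : ℝ) < m := by exact_mod_cast hm
  have hg : 0 < γ * m / K := by positivity
  rw [integral_weightedReward (measurable_mixLaw hpol)
    (isProbabilityMeasure_mixLaw hmK hγ0.le hγ1 hp) hD
    (integral_hit_mixLaw hm hmK hγ0.le hγ1 hp) (measurable_ipsWeight hpol j) (one_div_pos.2 hg).le
    fun x y => ⟨ipsWeight_nonneg hγ0.le hγ1 hp j x y, ipsWeight_le hg hγ1 hp j x y⟩]
  refine integral_congr_ae (Filter.Eventually.of_forall fun z => ?_)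
  simp only [sum_action_eq_sum_hit]
  refine Finset.sum_congr rfl fun y _ => ?_
  rw [ipsWeight, div_mul_cancel₀ _ (hg.trans_le (le_mixProb hγ1 hp z.1 y)).ne']

lemma integral_weightedReward_ipsWeight_sq_le [IsProbabilityMeasure D]
    (hpol : ∀ j, Measurable (pol j)) (hm : 0 < m) (hmK : m ≤ K) (hγ0 : 0 < γ) (hγ1 : γ ≤ 1)
    (hp : p ∈ stdSimplex ℝ ι)
    (hD : ∀ᵐ z ∂D, (∀ y, 0 ≤ z.2 y ∧ z.2 y ≤ 1) ∧ ∑ y, z.2 y ≤ s) (j : ι) :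
    ∫ o, weightedReward (ipsWeight pol γ p j) o ^ 2 ∂(roundLaw D (mixLaw pol γ p)) ≤
      m * ipsMoment D pol γ p j := by
  have hK : (0 : ℝ) < K := by exact_mod_cast hm.trans_le hmK
  have hm' : (0 : ℝ) < m := by exact_mod_cast hm
  have hg : 0 < γ * m / K := by positivity
  have hα := measurable_mixLaw (γ := γ) (p := p) hpol
  have hα1 := isProbabilityMeasure_mixLaw (pol := pol) hmK hγ0.le hγ1 hp
  have hw : ∀ x y, 0 ≤ ipsWeight pol γ p j x y ^ 2 ∧
      ipsWeight pol γ p j x y ^ 2 ≤ (1 / (γ * m / K)) ^ 2 := fun x y =>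
    ⟨sq_nonneg _, pow_le_pow_left₀ (ipsWeight_nonneg hγ0.le hγ1 hp j x y)
      (ipsWeight_le hg hγ1 hp j x y) 2⟩
  have hwm : ∀ y, Measurable fun x => ipsWeight pol γ p j x y ^ 2 := fun y =>
    (measurable_ipsWeight hpol j y).pow_const 2
  have hmean : ∫ o, weightedReward (fun x y => ipsWeight pol γ p j x y ^ 2) o
      ∂(roundLaw D (mixLaw pol γ p)) = ipsMoment D pol γ p j := by
    rw [integral_weightedReward hα hα1 hD (integral_hit_mixLaw hm hmK hγ0.le hγ1 hp) hwm
      (sq_nonneg _) hw]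
    refine integral_congr_ae (Filter.Eventually.of_forall fun z => ?_)
    refine Finset.sum_congr rfl fun y _ => ?_
    have hQ := hg.trans_le (le_mixProb (pol := pol) hγ1 hp z.1 y)
    simp only [ipsWeight]
    rcases hit_eq_zero_or_one (pol j z.1) y with h | h
    · simp [h]
    · rw [h]
      field_simp
  rw [← hmean, ← integral_const_mul]
  refine integral_mono_of_nonneg (Filter.Eventually.of_forall fun o => sq_nonneg _)
    ((integrable_weightedReward hα hα1 hD hwm (sq_nonneg _) hw).const_mul _) ?_
  filter_upwards [ae_obsReward hα hD] with o ho
  have hcs := Finset.sum_mul_sq_le_sq_mul_sq Finset.univ (fun y => hit (pol j o.1) y)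
    fun y => ipsWeight pol γ p j o.1 y * obsReward o y
  have e1 : ∑ y, hit (pol j o.1) y * (ipsWeight pol γ p j o.1 y * obsReward o y) =
      weightedReward (ipsWeight pol γ p j) o := by
    refine Finset.sum_congr rfl fun y _ => ?_
    rw [ipsWeight]
    rcases hit_eq_zero_or_one (pol j o.1) y with h | h <;> simp [h]
  have e2 : ∑ y, hit (pol j o.1) y ^ 2 = m := by
    rw [← sum_hit (pol j o.1)]
    refine Finset.sum_congr rfl fun y _ => ?_
    rcases hit_eq_zero_or_one (pol j o.1) y with h | h <;> simp [h]
  rw [e1, e2] at hcs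
  refine hcs.trans (mul_le_mul_of_nonneg_left (Finset.sum_le_sum fun y _ => ?_) hm'.le)
  rw [mul_pow]
  have : obsReward o y ^ 2 ≤ obsReward o y := by
    rw [sq]
    exact mul_le_of_le_one_right (ho.1 y).1 (ho.1 y).2
  exact mul_le_mul_of_nonneg_left this (sq_nonneg _)

/-- If all reward estimates have small second moments, then the second phase selects an
`ε`-optimal policy with high probability, by Bernstein's inequality. -/
lemma phase_two [IsProbabilityMeasure D] {oracle : ∀ n : ℕ, DataSet X K n → ι}
    (hO : IsERMOracle pol oracle) (hpol : ∀ j, Measurable (pol j)) (hm : 0 < m) (hmK : m ≤ K)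
    (hγ0 : 0 < γ) (hγ1 : γ ≤ 1) (hs : 0 < s)
    (hD : ∀ᵐ z ∂D, (∀ y, 0 ≤ z.2 y ∧ z.2 y ≤ 1) ∧ ∑ y, z.2 y ≤ s) (hp : p ∈ stdSimplex ℝ ι)
    {V ε : ℝ} (hV : ∀ j, ipsMoment D pol γ p j ≤ V) (hε : 0 < ε) {N : ℕ} (hN : 0 < N) :
    (Measure.pi fun _ : Fin N => roundLaw D (mixLaw pol γ p)).real
        {S | ¬ EpsOptimal D pol ε (selectedPolicy pol γ oracle p S)} ≤
      Fintype.card ι * (2 * Real.exp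
        (-(N * ε ^ 2 / (4 * (4 * (m * V) + 1 / (γ * m / K) * s * ε))))) := by
  have hK : (0 : ℝ) < K := by exact_mod_cast hm.trans_le hmK
  have hm' : (0 : ℝ) < m := by exact_mod_cast hm
  have hN' : (0 : ℝ) < N := by exact_mod_cast hN
  have hg : 0 < γ * m / K := by positivity
  have hα := measurable_mixLaw (γ := γ) (p := p) hpol
  have hround := isProbabilityMeasure_roundLaw_mixLaw (D := D) hpol hmK hγ0.le hγ1 hp
  set Y : ι → Obs X K m → ℝ := fun j => weightedReward (ipsWeight pol γ p j) with hY
  have hmean : ∀ j, ∫ o, Y j o ∂(roundLaw D (mixLaw pol γ p)) = policyReward D (pol j) :=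
    integral_weightedReward_ipsWeight hpol hm hmK hγ0 hγ1 hp hD
  have hbad : ∀ j, (Measure.pi fun _ : Fin N => roundLaw D (mixLaw pol γ p)).real
      {S | N * (ε / 2) ≤ |∑ i, Y j (S i) - N * policyReward D (pol j)|} ≤
      2 * Real.exp (-(N * ε ^ 2 / (4 * (4 * (m * V) + 1 / (γ * m / K) * s * ε)))) := fun j => by
    rw [← hmean]
    exact pi_real_abs_sub_mean_ge_le (measurable_weightedReward (measurable_ipsWeight hpol j))
      (mul_pos (one_div_pos.2 hg) hs) (ae_weightedReward hα hD (one_div_pos.2 hg).le fun x y =>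
        ⟨ipsWeight_nonneg hγ0.le hγ1 hp j x y, ipsWeight_le hg hγ1 hp j x y⟩)
      ((integral_weightedReward_ipsWeight_sq_le hpol hm hmK hγ0 hγ1 hp hD j).trans
        (mul_le_mul_of_nonneg_left (hV j) hm'.le)) hε N
  have hae : ∀ᵐ S ∂(Measure.pi fun _ : Fin N => roundLaw D (mixLaw pol γ p)),
      ∀ i y, 0 ≤ obsReward (S i) y := by
    rw [Filter.eventually_all]
    intro i
    filter_upwards [(Measure.tendsto_eval_ae_ae (μ := fun _ : Fin N => roundLaw D (mixLaw pol γ p))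
      (i := i)).eventually (ae_obsReward hα hD)] with S h y
    exact (h.1 y).1
  have hsub : {S : Fin N → Obs X K m |
        ¬ EpsOptimal D pol ε (selectedPolicy pol γ oracle p S)} ≤ᵐ[
      Measure.pi fun _ : Fin N => roundLaw D (mixLaw pol γ p)]
      (⋃ j, {S | N * (ε / 2) ≤ |∑ i, Y j (S i) - N * policyReward D (pol j)|} : Set _) := by
    filter_upwards [hae] with S hS hnot
    by_contra hgood
    replace hgood : ¬ S ∈ ⋃ j, {S | N * (ε / 2) ≤ |∑ i, Y j (S i) - N * policyReward D (pol j)|} :=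
      hgood
    simp only [Set.mem_iUnion, not_exists] at hgood
    refine hnot fun j' => ?_
    set j := selectedPolicy pol γ oracle p S with hj
    have hclose : ∀ j, |∑ i, Y j (S i) - N * policyReward D (pol j)| < N * (ε / 2) :=
      fun j => not_le.1 (hgood j)
    have hopt := hO.optimal N (fun i => ((S i).1, ipsReward pol γ p (S i))) (fun i y =>
      div_nonneg (hS i y) (hg.le.trans (le_mixProb hγ1 hp _ y))) j'
    simp only [sum_action_eq_sum_hit, sum_hit_mul_ipsReward] at hopt
    replace hopt : ∑ i, Y j' (S i) ≤ ∑ i, Y j (S i) := hopt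
    have h1 := (abs_lt.1 (hclose j')).1
    have h2 := (abs_lt.1 (hclose j)).2
    have h3 : N * (policyReward D (pol j') - policyReward D (pol j)) ≤ N * ε := by linarith
    exact le_of_mul_le_mul_left h3 hN'
  calc _ ≤ (Measure.pi fun _ : Fin N => roundLaw D (mixLaw pol γ p)).real
        (⋃ j, {S | N * (ε / 2) ≤ |∑ i, Y j (S i) - N * policyReward D (pol j)|}) :=
        ENNReal.toReal_mono (measure_ne_top _ _) (measure_mono_ae hsub)
    _ ≤ _ := (measureReal_iUnion_fintype_le _).trans (Finset.sum_le_sum fun j _ => hbad j)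
    _ = _ := by simp [Finset.card_univ]

end Moment

/-! ### The sample sizes -/

lemma half_le_of_floor_le {x : ℝ} {N : ℕ} (hx : 2 ≤ x) (h : ⌊x⌋₊ ≤ N) : x / 2 ≤ N := by
  have h1 := Nat.lt_floor_add_one x
  have h2 : (⌊x⌋₊ : ℝ) ≤ N := by exact_mod_cast h
  linarith

/-- The two failure probabilities of the first phase are at most `δ / 8` each. -/
lemma phase_one_failure_le {K m N : ℕ} {n δ : ℝ} (hm : 0 < m) (hmK : m ≤ K) (hn : 2 ≤ n)
    (hδ0 : 0 < δ) (hδ1 : δ < 1)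
    (hN : 10000 * ((K : ℝ) ^ 9 / (m : ℝ) ^ 8 * Real.log (n / δ)) ≤ N) :
    Real.exp (-(N * ((m : ℝ) / K) / 2)) +
      n ^ (2 * K + 1) * Real.exp (-(N * ((m : ℝ) / K) ^ 2 / 4)) ≤ δ / 4 := by
  have hK : (0 : ℝ) < K := by exact_mod_cast hm.trans_le hmK
  have hK1 : (1 : ℝ) ≤ K := by exact_mod_cast hm.trans_le hmK
  have hm' : (0 : ℝ) < m := by exact_mod_cast hm
  have hmK' : (m : ℝ) ≤ K := by exact_mod_cast hmK
  have hnδ : 0 < n / δ := by positivity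
  have hn1 : n ≤ n / δ := by
    rw [le_div_iff₀ hδ0]
    nlinarith
  set L : ℝ := Real.log (n / δ) with hL
  have hL0 : 0 ≤ L := Real.log_nonneg (by linarith)
  have hexpL : Real.exp L = n / δ := Real.exp_log hnδ
  set u : ℝ := (m : ℝ) / K with hu
  have hu0 : 0 < u := by positivity
  have hu1 : u ≤ 1 := by rwa [hu, div_le_one hK]
  -- `K ^ 9 / m ^ 8` is more than needed: the proof uses `K * (K / m) ^ 2` only.
  have hpow : (K : ℝ) ^ 9 / (m : ℝ) ^ 8 * u ^ 8 = K := by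
    rw [hu]
    field_simp
  have hNu : 10000 * (K * L) ≤ N * u ^ 2 := by
    have h1 : 10000 * (K * L) ≤ N * u ^ 8 := by
      calc 10000 * (K * L) = 10000 * ((K : ℝ) ^ 9 / (m : ℝ) ^ 8 * L) * u ^ 8 := by
            linear_combination (-(10000 * L)) * hpow
        _ ≤ N * u ^ 8 := mul_le_mul_of_nonneg_right hN (by positivity)
    exact h1.trans (mul_le_mul_of_nonneg_left (pow_le_pow_of_le_one hu0.le hu1 (by norm_num))
      N.cast_nonneg)
  have hKL : L ≤ K * L := le_mul_of_one_le_left hL0 hK1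
  have hNu1 : N * u ^ 2 ≤ N * u := by
    refine mul_le_mul_of_nonneg_left ?_ N.cast_nonneg
    nlinarith
  have hsmall : Real.exp (-(3 * L)) ≤ δ / 8 := by
    have : Real.exp (-(3 * L)) = (δ / n) ^ 3 := by
      rw [Real.exp_neg, show 3 * L = (3 : ℕ) * L by norm_num, Real.exp_nat_mul, hexpL, ← inv_pow,
        inv_div]
    rw [this]
    have h2 : δ / n ≤ δ / 2 := div_le_div_of_nonneg_left hδ0.le (by norm_num) hn
    calc (δ / n) ^ 3 ≤ (δ / 2) ^ 3 := pow_le_pow_left₀ (by positivity) h2 3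
      _ = δ / 8 * (δ * δ) := by ring
      _ ≤ δ / 8 := mul_le_of_le_one_right (by positivity) (by nlinarith)
  have h1 : Real.exp (-(N * u / 2)) ≤ Real.exp (-(3 * L)) :=
    Real.exp_le_exp.2 (by linarith)
  have h2 : n ^ (2 * K + 1) * Real.exp (-(N * u ^ 2 / 4)) ≤ Real.exp (-(3 * L)) := by
    calc _ ≤ Real.exp L ^ (2 * K + 1) * Real.exp (-(N * u ^ 2 / 4)) := by
          rw [hexpL]
          gcongr
      _ = Real.exp ((2 * K + 1 : ℕ) * L + -(N * u ^ 2 / 4)) := by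
          rw [← Real.exp_nat_mul, ← Real.exp_add]
      _ ≤ _ := by
          refine Real.exp_le_exp.2 ?_
          push_cast
          nlinarith
  linarith

/-- The failure probability of the second phase is at most `δ / 4`. -/
lemma phase_two_failure_le {K m N : ℕ} {n δ s ε : ℝ} (hm : 0 < m) (hmK : m ≤ K) (hn : 2 ≤ n)
    (hδ0 : 0 < δ) (hδ1 : δ < 1) (hs : 0 < s) (hε : 0 < ε)
    (hN : 10000 * ((s * K / (m * ε) + s * m / ε ^ 2) * Real.log (n / δ)) ≤ N) :
    n * (2 * Real.exp (-(N * ε ^ 2 /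
      (4 * (4 * (m * (122 * s)) + 1 / (1 / 2 * m / K) * s * ε))))) ≤ δ / 4 := by
  have hK : (0 : ℝ) < K := by exact_mod_cast hm.trans_le hmK
  have hm' : (0 : ℝ) < m := by exact_mod_cast hm
  have hn0 : 0 < n := by linarith
  have hnδ : 0 < n / δ := by positivity
  have hn1 : n ≤ n / δ := by
    rw [le_div_iff₀ hδ0]
    nlinarith
  set L : ℝ := Real.log (n / δ) with hL
  have hL0 : 0 ≤ L := Real.log_nonneg (by linarith)
  have hexpL : Real.exp L = n / δ := Real.exp_log hnδ
  have hNε : 10000 * ((s * K / m * ε + s * m) * L) ≤ N * ε ^ 2 := by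
    calc 10000 * ((s * K / m * ε + s * m) * L)
        = 10000 * ((s * K / (m * ε) + s * m / ε ^ 2) * L) * ε ^ 2 := by field_simp
      _ ≤ N * ε ^ 2 := mul_le_mul_of_nonneg_right hN (by positivity)
  have hexponent : 4 * L ≤ N * ε ^ 2 /
      (4 * (4 * (m * (122 * s)) + 1 / (1 / 2 * m / K) * s * ε)) := by
    rw [le_div_iff₀ (by positivity)]
    refine le_trans ?_ hNε
    have e : 1 / (1 / 2 * (m : ℝ) / K) * s * ε = 2 * (s * K / m * ε) := by field_simp
    rw [e]
    have h1 : 0 ≤ s * K / m * ε * L := by positivity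
    have h2 : 0 ≤ s * m * L := by positivity
    nlinarith
  have hsmall : Real.exp (-(4 * L)) = (δ / n) ^ 4 := by
    rw [Real.exp_neg, show 4 * L = (4 : ℕ) * L by norm_num, Real.exp_nat_mul, hexpL, ← inv_pow,
      inv_div]
  calc _ ≤ n * (2 * Real.exp (-(4 * L))) := by
        have := Real.exp_le_exp.2 (neg_le_neg hexponent)
        gcongr
    _ = 2 * δ * (δ / n) ^ 3 := by
        rw [hsmall]
        field_simp
    _ ≤ 2 * δ * (1 / 2) ^ 3 := by
        have : δ / n ≤ 1 / 2 := div_le_div₀ zero_le_one hδ1.le (by norm_num) hn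
        gcongr
    _ = δ / 4 := by ring

/-- The term of `N₂` that is linear in `1 / ε` is dominated by the other two terms, by the inequality
between the arithmetic and the geometric mean. -/
lemma mixed_term_le {K m : ℕ} {s ε : ℝ} (hm : 0 < m) (hmK : m ≤ K) (hs0 : 0 ≤ s) (hsK : s ≤ K)
    (hε : 0 < ε) : s * K / (m * ε) ≤ (K : ℝ) ^ 9 / (m : ℝ) ^ 8 + s * m / ε ^ 2 := by
  have hK : (0 : ℝ) < K := by exact_mod_cast hm.trans_le hmK
  have hK1 : (1 : ℝ) ≤ K := by exact_mod_cast hm.trans_le hmK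
  have hm' : (0 : ℝ) < m := by exact_mod_cast hm
  have hmK' : (m : ℝ) ≤ K := by exact_mod_cast hmK
  have h1 : s * K / (m * ε) ≤ s * K ^ 2 / m ^ 3 + s * m / ε ^ 2 := by
    have e : s * (K : ℝ) ^ 2 / (m : ℝ) ^ 3 + s * m / ε ^ 2 - s * K / (m * ε) =
        s * m * ((K / m ^ 2 - 1 / ε) ^ 2 + K / m ^ 2 * (1 / ε)) := by
      field_simp
      ring
    have : 0 ≤ s * m * (((K : ℝ) / m ^ 2 - 1 / ε) ^ 2 + K / m ^ 2 * (1 / ε)) := by positivity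
    linarith
  have h2 : s * (K : ℝ) ^ 2 / (m : ℝ) ^ 3 ≤ (K : ℝ) ^ 9 / (m : ℝ) ^ 8 := by
    rw [div_le_div_iff₀ (by positivity) (by positivity)]
    have h3 : (m : ℝ) ^ 5 ≤ K ^ 6 := (pow_le_pow_left₀ hm'.le hmK' 5).trans
      (pow_le_pow_right₀ hK1 (by norm_num))
    calc s * (K : ℝ) ^ 2 * m ^ 8 ≤ K * (K : ℝ) ^ 2 * m ^ 8 := by gcongr
      _ = (K : ℝ) ^ 3 * m ^ 3 * m ^ 5 := by ring
      _ ≤ (K : ℝ) ^ 3 * m ^ 3 * K ^ 6 := by gcongr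
      _ = _ := by ring
  linarith

lemma policyReward_mem_Icc {X : Type*} [MeasurableSpace X] {K m : ℕ}
    {D : Measure (X × (Fin K → ℝ))} [IsProbabilityMeasure D] {s : ℝ}
    (hD : ∀ᵐ z ∂D, (∀ y, 0 ≤ z.2 y ∧ z.2 y ≤ 1) ∧ ∑ y, z.2 y ≤ s) (π : X → Action K m) :
    policyReward D π ∈ Set.Icc 0 s := by
  have h0 : 0 ≤ᵐ[D] fun z => ∑ y ∈ (π z.1).1, z.2 y := by
    filter_upwards [hD] with z hz
    exact Finset.sum_nonneg fun y _ => (hz.1 y).1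
  refine ⟨integral_nonneg_of_ae h0, ?_⟩
  have h1 : policyReward D π ≤ ∫ _, s ∂D := by
    refine integral_mono_of_nonneg h0 (integrable_const s) ?_
    filter_upwards [hD] with z hz
    exact (Finset.sum_le_sum_of_subset_of_nonneg (Finset.subset_univ _)
      fun y _ _ => (hz.1 y).1).trans hz.2
  simpa using h1

/-- The algorithm fails with probability at most `δ`, outside of the trivial cases of a single
policy and of an accuracy `ε` that exceeds all rewards. -/
lemma law_pacComband_failure_le {X : Type*} [MeasurableSpace X] {ι : Type*} [Fintype ι]
    {K m : ℕ} {s ε δ : ℝ} {pol : ι → X → Action K m} {D : Measure (X × (Fin K → ℝ))}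
    [IsProbabilityMeasure D] {oracle : ∀ n : ℕ, DataSet X K n → ι} (hm : 0 < m) (hmK : m ≤ K)
    (hε : 0 < ε) (hεs : ε < s) (hδ0 : 0 < δ) (hδ1 : δ < 1) (hcard : 2 ≤ Fintype.card ι)
    (hpol : ∀ j, Measurable (pol j))
    (hD : ∀ᵐ z ∂D, (∀ y, 0 ≤ z.2 y ∧ z.2 y ≤ 1) ∧ ∑ y, z.2 y ≤ s)
    (hO : IsERMOracle pol oracle) {N₁ N₂ T : ℕ}
    (hN₁ : ⌊20000 * ((K : ℝ) ^ 9 / (m : ℝ) ^ 8 * Real.log (Fintype.card ι / δ))⌋₊ ≤ N₁)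
    (hN₂ : ⌊20000 * ((s * K / (m * ε) + s * m / ε ^ 2) * Real.log (Fintype.card ι / δ))⌋₊ ≤ N₂)
    (hT : ⌊20000 * ((K : ℝ) / m) ^ 5⌋₊ ≤ T) (j₀ : ι) :
    (pacComband pol (1 / 2) N₁ N₂ T j₀).law D oracle {o | ¬ EpsOptimal D pol ε o.policy} ≤
      ENNReal.ofReal δ := by
  have hK : (0 : ℝ) < K := by exact_mod_cast hm.trans_le hmK
  have hK1 : (1 : ℝ) ≤ K := by exact_mod_cast hm.trans_le hmK
  have hm' : (0 : ℝ) < m := by exact_mod_cast hm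
  have hmK' : (m : ℝ) ≤ K := by exact_mod_cast hmK
  have hs : 0 < s := hε.trans hεs
  have hn : (2 : ℝ) ≤ Fintype.card ι := by exact_mod_cast hcard
  have hκ : 1 ≤ (K : ℝ) / m := by rwa [one_le_div hm']
  have hL : 1 / 2 ≤ Real.log (Fintype.card ι / δ) := by
    have h1 : Real.log 2 ≤ Real.log (Fintype.card ι / δ) := by
      refine Real.log_le_log (by norm_num) ?_
      rw [le_div_iff₀ hδ0]
      nlinarith
    linarith [Real.log_two_gt_d9]
  have hfac₁ : 1 ≤ (K : ℝ) ^ 9 / (m : ℝ) ^ 8 := by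
    rw [one_le_div (by positivity)]
    exact (pow_le_pow_left₀ hm'.le hmK' 8).trans (pow_le_pow_right₀ hK1 (by norm_num))
  have hfac₂ : 1 ≤ s * K / (m * ε) + s * m / ε ^ 2 := by
    have h1 : 1 ≤ s * K / (m * ε) := by
      rw [one_le_div (by positivity), mul_comm s]
      exact mul_le_mul hmK' hεs.le hε.le hK.le
    have h2 : 0 ≤ s * m / ε ^ 2 := by positivity
    linarith
  have hN₁' : 10000 * ((K : ℝ) ^ 9 / (m : ℝ) ^ 8 * Real.log (Fintype.card ι / δ)) ≤ N₁ := by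
    have := half_le_of_floor_le (by nlinarith) hN₁
    linarith
  have hN₂' : 10000 * ((s * K / (m * ε) + s * m / ε ^ 2) * Real.log (Fintype.card ι / δ)) ≤
      N₂ := by
    have := half_le_of_floor_le (by nlinarith) hN₂
    linarith
  have hT' : 256 * ((K : ℝ) / m) ^ 3 ≤ T := by
    have h1 : (1 : ℝ) ≤ ((K : ℝ) / m) ^ 5 := one_le_pow₀ hκ
    have h2 := half_le_of_floor_le (by linarith) hT
    have h3 : ((K : ℝ) / m) ^ 3 ≤ ((K : ℝ) / m) ^ 5 := pow_le_pow_right₀ hκ (by norm_num)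
    linarith
  have hN₁0 : 0 < N₁ := by
    have : (0 : ℝ) < N₁ := by nlinarith
    exact_mod_cast this
  have hN₂0 : 0 < N₂ := by
    have : (0 : ℝ) < N₂ := by nlinarith
    exact_mod_cast this
  obtain ⟨bad, hbad, hgood⟩ := phase_one hO hpol hm hmK hs hD hN₁0 hT' j₀
  have hbad' := hbad.trans (phase_one_failure_le hm hmK hn hδ0 hδ1 hN₁')
  have hround := isProbabilityMeasure_roundLaw_uniformOn (D := D) hmK
  have h := law_pacComband_le (P := fun j => ¬ EpsOptimal D pol ε j)
    (b := ENNReal.ofReal (δ / 4)) hO hpol hmK (γ := 1 / 2) (by norm_num) (by norm_num)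
    N₁ N₂ T j₀ bad (by
      filter_upwards [hgood] with S₁ hS₁ hnot
      have hp : fwIter pol (1 / 2) oracle S₁ T 1 (delta j₀) ∈ stdSimplex ℝ ι :=
        fwIter_mem_stdSimplex T 1 _ le_rfl (delta_mem_stdSimplex j₀)
      have hround₂ := isProbabilityMeasure_roundLaw_mixLaw (D := D) (γ := 1 / 2) hpol hmK
        (by norm_num) (by norm_num) hp
      have h2 := (phase_two hO hpol hm hmK (γ := 1 / 2) (by norm_num) (by norm_num) hs hD hp
        (hS₁ hnot) hε hN₂0).trans (phase_two_failure_le hm hmK hn hδ0 hδ1 hs hε hN₂')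
      rw [← ofReal_measureReal]
      exact ENNReal.ofReal_le_ofReal h2)
  refine h.trans ?_
  rw [← ofReal_measureReal, ← ENNReal.ofReal_add measureReal_nonneg (by positivity)]
  exact ENNReal.ofReal_le_ofReal (by linarith)

end SemiBandit

theorem theorem1 :
    ∃ c : ℝ, 0 < c ∧ ∀ c' : ℝ, c ≤ c' → ∃ C : ℝ, 0 < C ∧
      ∀ (X : Type*) [MeasurableSpace X] (ι : Type*) [Fintype ι] [Nonempty ι]
        (K m : ℕ) (s ε δ : ℝ)
        (pol : ι → X → Action K m) (D : Measure (X × (Fin K → ℝ))) [IsProbabilityMeasure D]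
        (erm : ∀ n : ℕ, DataSet X K n → ι) (j₀ : ι),
        1 ≤ m → m ≤ K → s ≤ K → 0 < ε → 0 < δ → δ < 1 →
        (∀ j, Measurable (pol j)) →
        (∀ᵐ z ∂D, (∀ y, 0 ≤ z.2 y ∧ z.2 y ≤ 1) ∧ ∑ y, z.2 y ≤ s) →
        IsERMOracle pol erm →
        ∀ N₁ N₂ T : ℕ,
          ⌊c * ((K : ℝ) ^ 9 / (m : ℝ) ^ 8 * Real.log (Fintype.card ι / δ))⌋₊ ≤ N₁ →
          ⌊c * ((s * K / (m * ε) + s * m / ε ^ 2) * Real.log (Fintype.card ι / δ))⌋₊ ≤ N₂ →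
          ⌊c * ((K : ℝ) / m) ^ 5⌋₊ ≤ T →
          -- the output is `ε`-optimal with probability at least `1 - δ`
          1 - δ ≤ ((pacComband pol (1 / 2) N₁ N₂ T j₀).law D erm).real
              {o | EpsOptimal D pol ε o.policy} ∧
          -- the run uses `N₁ + N₂` samples and `T + 1` oracle calls
          (∀ᵐ o ∂((pacComband pol (1 / 2) N₁ N₂ T j₀).law D erm),
            o.samples = N₁ + N₂ ∧ o.ermCalls = T + 1) ∧
          -- and for parameters of the prescribed order these are bounded as claimed
          ((N₁ : ℝ) ≤ c' * ((K : ℝ) ^ 9 / (m : ℝ) ^ 8 * Real.log (Fintype.card ι / δ)) →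
            (N₂ : ℝ) ≤
              c' * ((s * K / (m * ε) + s * m / ε ^ 2) * Real.log (Fintype.card ι / δ)) →
            (N₁ : ℝ) + N₂ ≤
              C * (((K : ℝ) ^ 9 / (m : ℝ) ^ 8 + s * m / ε ^ 2) *
                Real.log (Fintype.card ι / δ))) ∧
          ((T : ℝ) ≤ c' * ((K : ℝ) / m) ^ 5 → (T : ℝ) + 1 ≤ C * ((K : ℝ) / m) ^ 5) := by
  refine ⟨20000, by norm_num, fun c' hc' => ⟨2 * c' + 1, by linarith, ?_⟩⟩
  intro X _ ι _ _ K m s ε δ pol D _ erm j₀ hm hmK hsK hε hδ0 hδ1 hpol hD hO N₁ N₂ T hN₁ hN₂ hT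
  have hm0 : 0 < m := hm
  have hm' : (0 : ℝ) < m := by exact_mod_cast hm0
  have hK : (0 : ℝ) < K := by exact_mod_cast hm0.trans_le hmK
  have hprob := isProbabilityMeasure_law_pacComband (D := D) hO hpol hmK (γ := 1 / 2)
    (by norm_num) (by norm_num) N₁ N₂ T j₀
  have hs0 : 0 ≤ s := by
    obtain ⟨z, hz⟩ := hD.exists
    exact (Finset.sum_nonneg fun y _ => (hz.1 y).1).trans hz.2
  have hL0 : 0 ≤ Real.log (Fintype.card ι / δ) := by
    refine Real.log_nonneg ?_
    have h1 : (1 : ℝ) ≤ Fintype.card ι := by exact_mod_cast Fintype.card_pos (α := ι)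
    rw [le_div_iff₀ hδ0]
    linarith
  refine ⟨?_, ae_law_pacComband hO hpol N₁ N₂ T j₀, ?_, ?_⟩
  · by_cases htriv : ∀ j, EpsOptimal D pol ε j
    · simp only [htriv, Set.ofPred_true, probReal_univ]
      linarith
    · have hcard : 2 ≤ Fintype.card ι := by
        by_contra hlt
        have : Subsingleton ι := Fintype.card_le_one_iff_subsingleton.1 (by omega)
        exact htriv fun j j' => by rw [Subsingleton.elim j' j, sub_self]; exact hε.le
      have hεs : ε < s := by
        by_contra hle
        refine htriv fun j j' => ?_
        linarith [(policyReward_mem_Icc hD (pol j)).1, (policyReward_mem_Icc hD (pol j')).2]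
      have hfail := law_pacComband_failure_le hm0 hmK hε hεs hδ0 hδ1 hcard hpol hD hO
        hN₁ hN₂ hT j₀
      have hcompl := probReal_compl_eq_one_sub (μ := (pacComband pol (1 / 2) N₁ N₂ T j₀).law D erm)
        (s := {o | EpsOptimal D pol ε o.policy}) (DiscreteMeasurableSpace.forall_measurableSet _)
      have hreal : ((pacComband pol (1 / 2) N₁ N₂ T j₀).law D erm).real
          {o | EpsOptimal D pol ε o.policy}ᶜ ≤ δ := ENNReal.toReal_le_of_le_ofReal hδ0.le hfail
      linarith
  · intro h1 h2
    have hmix := mixed_term_le hm0 hmK hs0 hsK hε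
    have hc0 : 0 ≤ c' := by linarith
    have hF : 0 ≤ (K : ℝ) ^ 9 / (m : ℝ) ^ 8 + s * m / ε ^ 2 := by positivity
    have h3 := mul_le_mul_of_nonneg_left (mul_le_mul_of_nonneg_right hmix hL0) hc0
    have h4 := mul_nonneg hF hL0
    linarith
  · intro h1
    have hκ : 1 ≤ ((K : ℝ) / m) ^ 5 := one_le_pow₀ (by
      rw [one_le_div hm']
      exact_mod_cast hmK)
    nlinarith
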